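/- **Setting.** Let $M$ be a smooth manifold of dimension $n+1$ with a sub-Riemannian structure: a smooth distribution $V_0\subset TM$ of constant rank and a smooth inner product $\langle\cdot,\cdot\rangle$ on $V_0$. A *vertically rigid structure* on it consists of a complement $V$ of $V_0$ in $TM$, a smooth global frame $T_1,\dots,T_m$ of $V$, a Riemannian metric $g$ that agrees with $\langle\cdot,\cdot\rangle$ on $V_0$ and for which $V_0\perp V$ and $T_1,\dots,T_m$ are orthonormal, and an equivalence relation $\sim$ on $\{1,\dots,m\}$ such that $g([X,T_j],T_i)=0$ for every smooth section $X$ of $V_0$ whenever $j\sim i$. A smooth connection $\nabla$ on $TM$ is *adapted* to it if $\nabla g=0$, $\nabla T_j=0$ for all $j$, and $\mathrm{Tor}_p(X,Y)\in V_p$ for all $X,Y\in (V_0)_p$, $p\in M$. A *noncharacteristic patch* is a $C^2$ immersion $\iota:\Sigma\to M$ of an $n$-dimensional $C^2$ manifold with $(V_0)_{\iota(x)}\not\subset d\iota(T_x\Sigma)$ for all $x\in \Sigma$, oriented by a $C^1$ horizontal unit normal $\nu$: a field of unit vectors of $V_0$ along $\iota$ such that $\nu(x)$ is the $V_0$-component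 of a vector $g$-orthogonal to $d\iota(T_x\Sigma)$. It is *minimal* if it satisfies the minimal surface equation $H=0$, where $H(x)=\sum_j\langle\nabla_{e_j}\nu,e_j\rangle$ is the trace of the horizontal second fundamental form $II_0=(\langle\nabla_{e_i}\nu,e_j\rangle)_{i,j}$ with respect to any orthonormal basis $(e_j)$ of $V_0\cap d\iota(T_x\Sigma)$. **Statement.** Let $M$ carry a vertically rigid structure with $\dim V_0=2$, let $\nabla$ be any connection adapted to it, and let $\Sigma$ be a minimal noncharacteristic patch with horizontal unit normal $\nu$. Call a $C^1$ curve $c:J\to\Sigma$ on a nonempty open interval $J\subset\mathbb R$ a *ruling curve* if the velocity of $\gamma=\iota\circ c$ is horizontal, of unit length and orthogonal to $\nu$; that is, if $c$ is an integral curve of the horizontal unit field $\nu^\perp$ orthogonal to $\nu$ (which is determined up to sign). Then: 1. every ruling curve is a horizontal $\nabla$-geodesic: $\gamma=\iota\circ c$ is $C^2$ and $\nabla_{\dot\gamma}\dot\gamma=0$; 2. the ruling curves foliate $\Sigma$: there is a partition of $\Sigma$ into leaves such that each leaf is the image of a single ruling curve, every ruling curve runs inside one leaf, and every point of $\Sigma$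 lies in the domain of a homeomorphism $\varphi$ from an open subset of $\Sigma$ onto a product $(-\varepsilon,\varepsilon)\times U$ with $\varepsilon>0$ and $U\subset\mathbb R^{n-1}$ open, such that for each $y\in U$ the curve $t\mapsto\varphi^{-1}(t,y)$ is a ruling curve, and its image lies inside one leaf. -/

import Mathlib

open Set Bundle
open scoped Manifold ContDiff Topology

namespace SubRiemannianGeometry

noncomputable section

section Definitions

variable {d n : ℕ}
  {M : Type*} [TopologicalSpace M] [ChartedSpace (EuclideanSpace ℝ (Fin d)) M]
  {P : Type*} [TopologicalSpace P] [ChartedSpace (EuclideanSpace ℝ (Fin n)) P]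

/-- `X` is a smooth vector field on the set `U`. -/
def IsSmoothFieldOn [IsManifold (𝓡 d) ∞ M] (X : Π p : M, TangentSpace (𝓡 d) p) (U : Set M) :
    Prop :=
  ContMDiffOn (𝓡 d) (𝓡 d).tangent ∞ (fun p : M ↦ (⟨p, X p⟩ : TangentBundle (𝓡 d) M)) U

/-- A sub-Riemannian structure on a smooth manifold `M`: a smooth distribution `V₀ ⊆ TM` of
constant rank together with a smooth inner product on `V₀`. -/
structure SubRiemannianStructure (d : ℕ) (M : Type*) [TopologicalSpace M]
    [ChartedSpace (EuclideanSpace ℝ (Fin d)) M] [IsManifold (𝓡 d) ∞ M] where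
  /-- the dimension of `V₀` -/
  rank : ℕ
  /-- the distribution `V₀` -/
  horizontal (p : M) : Submodule ℝ (TangentSpace (𝓡 d) p)
  finrank_horizontal (p : M) : Module.finrank ℝ (horizontal p) = rank
  /-- `V₀` is smooth: near every point it is spanned by `rank` many smooth vector fields. -/
  exists_smooth_frame (p : M) : ∃ U : Set M, IsOpen U ∧ p ∈ U ∧
    ∃ X : Fin rank → Π q : M, TangentSpace (𝓡 d) q,
      (∀ i, IsSmoothFieldOn (X i) U) ∧
      ∀ q ∈ U, Submodule.span ℝ (range fun i ↦ X i q) = horizontal q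
  /-- the inner product on `V₀` -/
  inner (p : M) : horizontal p →ₗ[ℝ] horizontal p →ₗ[ℝ] ℝ
  inner_symm (p : M) (u v : horizontal p) : inner p u v = inner p v u
  inner_pos (p : M) (v : horizontal p) : v ≠ 0 → 0 < inner p v v
  inner_smooth (U : Set M) (_ : IsOpen U) (X Y : Π p : M, horizontal p) :
    IsSmoothFieldOn (fun p ↦ (X p : TangentSpace (𝓡 d) p)) U →
    IsSmoothFieldOn (fun p ↦ (Y p : TangentSpace (𝓡 d) p)) U →
    ContMDiffOn (𝓡 d) 𝓘(ℝ, ℝ) ∞ (fun p ↦ inner p (X p) (Y p)) U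

/-- A vertically rigid complement of a sub-Riemannian structure. -/
structure VerticallyRigidStructure [IsManifold (𝓡 d) ∞ M] (S : SubRiemannianStructure d M) where
  /-- the complement `V` of `V₀` -/
  vertical (p : M) : Submodule ℝ (TangentSpace (𝓡 d) p)
  isCompl (p : M) : IsCompl (S.horizontal p) (vertical p)
  /-- the rank of `V` -/
  corank : ℕ
  /-- the smooth global frame `T₁, …, T_m` of `V` -/
  frame : Fin corank → Π p : M, TangentSpace (𝓡 d) p
  frame_smooth (i : Fin corank) : IsSmoothFieldOn (frame i) univ
  span_frame (p : M) : Submodule.span ℝ (range fun i ↦ frame i p) = vertical p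
  /-- the Riemannian metric `g` -/
  metric : ContMDiffRiemannianMetric (𝓡 d) ∞ (EuclideanSpace ℝ (Fin d))
    (fun p : M ↦ TangentSpace (𝓡 d) p)
  metric_orthogonal (p : M) : ∀ u ∈ S.horizontal p, ∀ w ∈ vertical p, metric.inner p u w = 0
  metric_horizontal (p : M) (u v : S.horizontal p) :
    metric.inner p (u : TangentSpace (𝓡 d) p) (v : TangentSpace (𝓡 d) p) = S.inner p u v
  frame_orthonormal (p : M) (i j : Fin corank) :
    metric.inner p (frame i p) (frame j p) = if i = j then 1 else 0
  /-- the equivalence relation whose classes form the partition of the index set -/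
  rel : Setoid (Fin corank)
  rigid (i j : Fin corank) : rel j i → ∀ X : Π p : M, TangentSpace (𝓡 d) p,
    IsSmoothFieldOn X univ → (∀ p, X p ∈ S.horizontal p) →
    ∀ p, metric.inner p (VectorField.mlieBracket (𝓡 d) X (frame j) p) (frame i p) = 0

/-- A (smooth, affine) connection on `TM`. Mathlib's argument order: `cov Y p v` is `∇_v Y` at
`p`. -/
abbrev TangentConnection (d : ℕ) (M : Type*) [TopologicalSpace M]
    [ChartedSpace (EuclideanSpace ℝ (Fin d)) M] [IsManifold (𝓡 d) ∞ M] :=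
  CovariantDerivative (𝓡 d) (EuclideanSpace ℝ (Fin d)) (fun p : M ↦ TangentSpace (𝓡 d) p)

/-- A connection `∇` on `TM` is adapted to a vertically rigid structure if it is compatible with
`g`, the frame fields `T_j` are parallel, and the torsion of two horizontal vectors is vertical. -/
structure IsAdapted [IsManifold (𝓡 d) ∞ M] {S : SubRiemannianStructure d M}
    (V : VerticallyRigidStructure S) (cov : TangentConnection d M) : Prop where
  smooth : cov.ContMDiffCovariantDerivative ∞
  metric_compatible :
    letI : RiemannianBundle (fun p : M ↦ TangentSpace (𝓡 d) p) := ⟨V.metric.toRiemannianMetric⟩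
    haveI : IsContMDiffRiemannianBundle (𝓡 d) ∞ (EuclideanSpace ℝ (Fin d))
      (fun p : M ↦ TangentSpace (𝓡 d) p) := ⟨V.metric.inner, V.metric.contMDiff, fun _ _ _ ↦ rfl⟩
    cov.IsMetricCompatible
  parallel (j : Fin V.corank) (p : M) : cov (V.frame j) p = 0
  torsion (p : M) : ∀ u ∈ S.horizontal p, ∀ v ∈ S.horizontal p,
    cov.torsion p u v ∈ V.vertical p

/-- The covariant derivative (pullback connection) of a vector field `W` along a map
`f : N → M`, at `y` and in the direction of a tangent vector of `N`. If `E_i` is the frame of `TM`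
given by the bundle trivialization at `f y` and `W = ∑ wⁱ E_i ∘ f` near `y`, this is
`v ↦ ∑ dwⁱ(v) E_i + ∑ wⁱ(y) ∇_{df(v)} E_i`. -/
def covAlong [IsManifold (𝓡 d) ∞ M] (cov : TangentConnection d M)
    {E' H' : Type*} [NormedAddCommGroup E'] [NormedSpace ℝ E'] [TopologicalSpace H']
    (J : ModelWithCorners ℝ E' H') {N : Type*} [TopologicalSpace N] [ChartedSpace H' N]
    (f : N → M) (W : Π y : N, TangentSpace (𝓡 d) (f y)) (y : N) :
    TangentSpace J y →L[ℝ] TangentSpace (𝓡 d) (f y) :=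
  let e := trivializationAt (EuclideanSpace ℝ (Fin d)) (fun p : M ↦ TangentSpace (𝓡 d) p) (f y)
  (e.symmL ℝ (f y)).comp
      (mfderiv J 𝓘(ℝ, EuclideanSpace ℝ (Fin d))
        (fun z ↦ (e (⟨f z, W z⟩ : TangentBundle (𝓡 d) M)).2) y) +
    (cov (FiberBundle.extend (EuclideanSpace ℝ (Fin d)) (W y)) (f y)).comp (mfderiv J (𝓡 d) f y)

/-- The velocity of a curve in `M`. -/
def velocity (γ : ℝ → M) (t : ℝ) : TangentSpace (𝓡 d) (γ t) :=
  mfderiv 𝓘(ℝ, ℝ) (𝓡 d) γ t (1 : ℝ)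

/-- On the open set `J` of times, `γ` is a `∇`-geodesic: it is `C²` and `∇_γ' γ' = 0`. -/
def IsGeodesicOn [IsManifold (𝓡 d) ∞ M] (cov : TangentConnection d M) (γ : ℝ → M) (J : Set ℝ) :
    Prop :=
  ContMDiffOn 𝓘(ℝ, ℝ) (𝓡 d) 2 γ J ∧
    ∀ t ∈ J, covAlong cov 𝓘(ℝ, ℝ) γ (velocity γ) t (1 : ℝ) = 0

/-- The image `dι(T_xP)` of the tangent space of `P` under the differential of `ι : P → M`. -/
def tangentImage (ι : P → M) (x : P) : Submodule ℝ (TangentSpace (𝓡 d) (ι x)) :=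
  LinearMap.range (mfderiv (𝓡 n) (𝓡 d) ι x).toLinearMap

/-- `ι : P → M` is a noncharacteristic `C²` hypersurface patch (when `dim M = dim P + 1`) with
horizontal unit normal `ν`. The normal is the `V₀`-component of a vector that is `g`-normal to the
hypersurface, normalized to unit length. -/
structure IsNoncharacteristicPatch [IsManifold (𝓡 d) ∞ M] [IsManifold (𝓡 n) 2 P]
    {S : SubRiemannianStructure d M} (V : VerticallyRigidStructure S) (ι : P → M)
    (ν : Π x : P, TangentSpace (𝓡 d) (ι x)) : Prop where
  contMDiff : ContMDiff (𝓡 n) (𝓡 d) 2 ι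
  immersive (x : P) : Function.Injective (mfderiv (𝓡 n) (𝓡 d) ι x)
  noncharacteristic (x : P) : ¬ S.horizontal (ι x) ≤ tangentImage (n := n) ι x
  normal_contMDiff : ContMDiff (𝓡 n) (𝓡 d).tangent 1
    (fun x ↦ (⟨ι x, ν x⟩ : TangentBundle (𝓡 d) M))
  normal_horizontal (x : P) : ν x ∈ S.horizontal (ι x)
  normal_unit (x : P) : V.metric.inner (ι x) (ν x) (ν x) = 1
  normal_projection (x : P) : ∃ N : TangentSpace (𝓡 d) (ι x),
    (∀ u ∈ tangentImage (n := n) ι x, V.metric.inner (ι x) N u = 0) ∧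
      N - ν x ∈ V.vertical (ι x)

/-- `e₁, …, e_k` is a `g`-orthonormal basis of the horizontal part `V₀ ∩ dι(T_xP)` of the tangent
space of the hypersurface at `x` (given by vectors of `T_xP`). -/
structure IsHorizontalFrame [IsManifold (𝓡 d) ∞ M] {S : SubRiemannianStructure d M}
    (V : VerticallyRigidStructure S) (ι : P → M) (x : P) {k : ℕ}
    (e : Fin k → TangentSpace (𝓡 n) x) : Prop where
  orthonormal (i j : Fin k) : V.metric.inner (ι x)
    (mfderiv (𝓡 n) (𝓡 d) ι x (e i)) (mfderiv (𝓡 n) (𝓡 d) ι x (e j)) = if i = j then 1 else 0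
  span : Submodule.span ℝ (range fun i ↦ mfderiv (𝓡 n) (𝓡 d) ι x (e i)) =
    S.horizontal (ι x) ⊓ tangentImage (n := n) ι x

/-- The horizontal second fundamental form `II₀ = (⟨∇_{e_i} ν, e_j⟩)_{i,j}` at `x` with respect to
the horizontal frame `e`. -/
def secondFundamentalForm [IsManifold (𝓡 d) ∞ M] {S : SubRiemannianStructure d M}
    (V : VerticallyRigidStructure S) (cov : TangentConnection d M) (ι : P → M)
    (ν : Π x : P, TangentSpace (𝓡 d) (ι x)) (x : P) {k : ℕ}
    (e : Fin k → TangentSpace (𝓡 n) x) : Matrix (Fin k) (Fin k) ℝ :=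
  Matrix.of fun i j ↦ V.metric.inner (ι x)
    (covAlong cov (𝓡 n) ι ν x (e i)) (mfderiv (𝓡 n) (𝓡 d) ι x (e j))

/-- The patch satisfies the minimal surface equation: the horizontal mean curvature
`H = Trace II₀` vanishes identically. -/
def IsMinimal [IsManifold (𝓡 d) ∞ M] {S : SubRiemannianStructure d M}
    (V : VerticallyRigidStructure S) (cov : TangentConnection d M) (ι : P → M)
    (ν : Π x : P, TangentSpace (𝓡 d) (ι x)) : Prop :=
  ∀ (x : P) (k : ℕ) (e : Fin k → TangentSpace (𝓡 n) x), IsHorizontalFrame V ι x e →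
    (secondFundamentalForm V cov ι ν x e).trace = 0

/-- `c : J → P` is a curve in the patch, on an open interval `J`, which is an integral curve of the
horizontal unit field orthogonal to `ν`: its velocity in `M` is continuous, horizontal, of unit
length and orthogonal to `ν`. (For `dim V₀ = 2` the field is determined by `ν` up to sign, and it
need not have a consistent sign globally, so it is not chosen.) -/
structure IsRulingCurve [IsManifold (𝓡 d) ∞ M] [IsManifold (𝓡 n) 2 P]
    {S : SubRiemannianStructure d M} (V : VerticallyRigidStructure S) (ι : P → M)
    (ν : Π x : P, TangentSpace (𝓡 d) (ι x)) (c : ℝ → P) (J : Set ℝ) : Prop where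
  isOpen : IsOpen J
  ordConnected : J.OrdConnected
  nonempty : J.Nonempty
  contMDiffOn : ContMDiffOn 𝓘(ℝ, ℝ) (𝓡 n) 1 c J
  horizontal : ∀ t ∈ J, velocity (d := d) (fun s ↦ ι (c s)) t ∈ S.horizontal (ι (c t))
  unit_speed : ∀ t ∈ J, V.metric.inner (ι (c t)) (velocity (d := d) (fun s ↦ ι (c s)) t)
    (velocity (d := d) (fun s ↦ ι (c s)) t) = 1
  orthogonal : ∀ t ∈ J, V.metric.inner (ι (c t)) (velocity (d := d) (fun s ↦ ι (c s)) t)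
    (ν (c t)) = 0

/-- The sets in `L` are the leaves of a one-dimensional foliation of the `n`-manifold `P` by curves
of the class `C` (where `C c J` means that `c`, restricted to the open interval `J`, is of this
class): they partition `P`, each is traced out by a single curve of the class, each curve of the
class runs inside one leaf, and `P` is covered by product charts whose plaques are traced out by
curves of the class and lie inside leaves. -/
structure IsFoliationByCurves (n : ℕ) {P : Type*} [TopologicalSpace P]
    (C : (ℝ → P) → Set ℝ → Prop) (L : Set (Set P)) : Prop where
  isPartition : Setoid.IsPartition L
  leaf_eq_image : ∀ A ∈ L, ∃ (c : ℝ → P) (J : Set ℝ), C c J ∧ c '' J = A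
  image_subset_leaf : ∀ (c : ℝ → P) (J : Set ℝ), C c J → ∃ A ∈ L, c '' J ⊆ A
  exists_chart : ∀ x : P, ∃ (φ : OpenPartialHomeomorph P (ℝ × EuclideanSpace ℝ (Fin (n - 1))))
    (ε : ℝ) (U : Set (EuclideanSpace ℝ (Fin (n - 1)))),
    x ∈ φ.source ∧ 0 < ε ∧ φ.target = Ioo (-ε) ε ×ˢ U ∧
    (∀ y ∈ U, C (fun t ↦ φ.symm (t, y)) (Ioo (-ε) ε)) ∧
    ∀ A ∈ L, ∀ a ∈ φ.source, ∀ b ∈ φ.source, (φ a).2 = (φ b).2 → a ∈ A → b ∈ A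

end Definitions

end

end SubRiemannianGeometry

/-! Since 2 + n > n + 1, the plane V₀ meets the image of TΣ in a nonzero vector. Such a vector is
orthogonal to ν, so V₀ ∩ dι(TΣ) is exactly the line of V₀ orthogonal to ν. Ruling curves are thus
the unit-speed integral curves of a line field on Σ, which `exists_local_ruling_field` represents
near each point by a C¹ vector field, unique up to sign.

Geodesics (`covAlong_velocity_ruling_eq_zero`): let X be the velocity of γ and Y = ∇_X X.
Differentiate three constant functions along γ with the product rule `hasDerivAt_metric_along`. From
⟨X, X⟩ = 1 comes Y ⟂ X. From ⟨X, ν⟩ = 0 comes ⟨Y, ν⟩ = -⟨X, ∇_X ν⟩ = -H = 0, because X alone is an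
orthonormal basis of the horizontal tangent line, so II₀ is a 1 × 1 matrix. From ⟨X, T_j⟩ = 0 and
∇T_j = 0 comes Y ⟂ T_j. As X, ν and the T_j span the tangent space, Y = 0. The regularity of γ is a
bootstrap: its velocity is a C¹ field evaluated along a C¹ curve, so γ is C².

Foliation (`exists_isFoliationByCurves`): flow boxes of the local C¹ fields are the product charts,
and leaves are images of maximal ruling curves. A line field need not have a global orientation, so
curves through a point are locally unique only up to reversal. `IsCurveLaw` isolates what the gluing
of leaves needs, and the reversed case is excluded in unique continuation because a ruling curve
does not locally fold back on itself. -/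

namespace SubRiemannianGeometry

/-! ### Vector fields along a map, read in a trivialization of TM. -/

section FieldCoordinates

variable {d : ℕ} {M : Type*} [TopologicalSpace M] [ChartedSpace (EuclideanSpace ℝ (Fin d)) M]
  [IsManifold (𝓡 d) 1 M]
  {E' H' : Type*} [NormedAddCommGroup E'] [NormedSpace ℝ E'] [TopologicalSpace H']
  {J : ModelWithCorners ℝ E' H'} {N : Type*} [TopologicalSpace N] [ChartedSpace H' N]

/-- The tangent vector field `W` along `f`, read in the trivialization of `TM` at `p₀`. -/
noncomputable def fieldCoord (f : N → M) (W : Π y : N, TangentSpace (𝓡 d) (f y)) (p₀ : M) :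
    N → EuclideanSpace ℝ (Fin d) :=
  fun z ↦ (trivializationAt (EuclideanSpace ℝ (Fin d)) (fun p : M ↦ TangentSpace (𝓡 d) p) p₀
    (⟨f z, W z⟩ : TangentBundle (𝓡 d) M)).2

/-- The vector field `σ`, read in the trivialization of `TM` at `p₀`. -/
noncomputable def sectionCoord (σ : Π q : M, TangentSpace (𝓡 d) q) (p₀ : M) :
    M → EuclideanSpace ℝ (Fin d) :=
  fun q ↦ (trivializationAt (EuclideanSpace ℝ (Fin d)) (fun p : M ↦ TangentSpace (𝓡 d) p) p₀
    (⟨q, σ q⟩ : TangentBundle (𝓡 d) M)).2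

theorem mem_trivializationAt_baseSet (p : M) :
    p ∈ (trivializationAt (EuclideanSpace ℝ (Fin d))
      (fun p : M ↦ TangentSpace (𝓡 d) p) p).baseSet :=
  FiberBundle.mem_baseSet_trivializationAt' p

theorem sectionCoord_eq (σ : Π q : M, TangentSpace (𝓡 d) q) {p₀ q : M}
    (hq : q ∈ (trivializationAt (EuclideanSpace ℝ (Fin d))
      (fun p : M ↦ TangentSpace (𝓡 d) p) p₀).baseSet) :
    sectionCoord σ p₀ q = (trivializationAt (EuclideanSpace ℝ (Fin d))
      (fun p : M ↦ TangentSpace (𝓡 d) p) p₀).continuousLinearEquivAt ℝ q hq (σ q) := by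
  rfl

theorem symmL_sectionCoord (σ : Π q : M, TangentSpace (𝓡 d) q) {p₀ q : M}
    (hq : q ∈ (trivializationAt (EuclideanSpace ℝ (Fin d))
      (fun p : M ↦ TangentSpace (𝓡 d) p) p₀).baseSet) :
    (trivializationAt (EuclideanSpace ℝ (Fin d)) (fun p : M ↦ TangentSpace (𝓡 d) p) p₀).symmL ℝ q
      (sectionCoord σ p₀ q) = σ q := by
  rw [sectionCoord_eq _ hq, Trivialization.coe_continuousLinearEquivAt_eq]
  exact Trivialization.symmL_continuousLinearMapAt _ hq (σ q)

omit [TopologicalSpace N] in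
theorem fieldCoord_eq {f : N → M} (W : Π y : N, TangentSpace (𝓡 d) (f y)) {p₀ : M} {z : N}
    (hz : f z ∈ (trivializationAt (EuclideanSpace ℝ (Fin d))
      (fun p : M ↦ TangentSpace (𝓡 d) p) p₀).baseSet) :
    fieldCoord f W p₀ z = (trivializationAt (EuclideanSpace ℝ (Fin d))
      (fun p : M ↦ TangentSpace (𝓡 d) p) p₀).continuousLinearEquivAt ℝ (f z) hz (W z) := by
  rfl

omit [TopologicalSpace N] in
theorem symmL_fieldCoord {f : N → M} (W : Π y : N, TangentSpace (𝓡 d) (f y)) {p₀ : M} {z : N}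
    (hz : f z ∈ (trivializationAt (EuclideanSpace ℝ (Fin d))
      (fun p : M ↦ TangentSpace (𝓡 d) p) p₀).baseSet) :
    (trivializationAt (EuclideanSpace ℝ (Fin d))
      (fun p : M ↦ TangentSpace (𝓡 d) p) p₀).symmL ℝ (f z) (fieldCoord f W p₀ z) = W z := by
  rw [fieldCoord_eq _ hz, Trivialization.coe_continuousLinearEquivAt_eq]
  exact Trivialization.symmL_continuousLinearMapAt _ hz (W z)

/-- The standard extension of a vector is constant in the trivialization at its base point. It
therefore serves as a parallel field of the local flat connection. -/
theorem sectionCoord_extend {p q : M} (u : TangentSpace (𝓡 d) p)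
    (hq : q ∈ (trivializationAt (EuclideanSpace ℝ (Fin d))
      (fun p : M ↦ TangentSpace (𝓡 d) p) p).baseSet) :
    sectionCoord (FiberBundle.extend (EuclideanSpace ℝ (Fin d)) u) p q =
      (trivializationAt (EuclideanSpace ℝ (Fin d))
      (fun p : M ↦ TangentSpace (𝓡 d) p) p (⟨p, u⟩ : TangentBundle (𝓡 d) M)).2 := by
  simp only [sectionCoord, FiberBundle.extend]
  rw [Trivialization.apply_mk_symm _ hq]

theorem mdifferentiableAt_field_iff {f : N → M} {W : Π y : N, TangentSpace (𝓡 d) (f y)} {y : N} :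
    MDifferentiableAt J (𝓡 d).tangent (fun z ↦ (⟨f z, W z⟩ : TangentBundle (𝓡 d) M)) y ↔
      MDifferentiableAt J (𝓡 d) f y ∧
      MDifferentiableAt J 𝓘(ℝ, EuclideanSpace ℝ (Fin d)) (fieldCoord f W (f y)) y :=
  mdifferentiableAt_totalSpace _ _

theorem contMDiffAt_field_iff {f : N → M} {W : Π y : N, TangentSpace (𝓡 d) (f y)} {y : N}
    {k : WithTop ℕ∞} :
    ContMDiffAt J (𝓡 d).tangent k (fun z ↦ (⟨f z, W z⟩ : TangentBundle (𝓡 d) M)) y ↔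
      ContMDiffAt J (𝓡 d) k f y ∧
      ContMDiffAt J 𝓘(ℝ, EuclideanSpace ℝ (Fin d)) k (fieldCoord f W (f y)) y :=
  contMDiffAt_totalSpace

theorem eventually_mem_baseSet {f : N → M} {y : N} (hf : ContinuousAt f y) :
    ∀ᶠ z in 𝓝 y, f z ∈ (trivializationAt (EuclideanSpace ℝ (Fin d))
      (fun p : M ↦ TangentSpace (𝓡 d) p) (f y)).baseSet :=
  hf.eventually ((Trivialization.open_baseSet _).mem_nhds (mem_trivializationAt_baseSet (f y)))

/-- A curve in a chart has the coordinates of its velocity as derivative. -/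
theorem hasDerivAt_extChartAt_comp {γ : ℝ → M} {t : ℝ} {p : M}
    (hγ : MDifferentiableAt 𝓘(ℝ, ℝ) (𝓡 d) γ t)
    (hp : γ t ∈ (chartAt (EuclideanSpace ℝ (Fin d)) p).source) :
    HasDerivAt (fun s ↦ extChartAt (𝓡 d) p (γ s))
      (fieldCoord γ (fun s ↦ velocity (d := d) γ s) p t) t := by
  have h1 : MDifferentiableAt (𝓡 d) 𝓘(ℝ, EuclideanSpace ℝ (Fin d)) (extChartAt (𝓡 d) p) (γ t) :=
    mdifferentiableAt_extChartAt hp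
  have h2 : HasMFDerivAt 𝓘(ℝ, ℝ) 𝓘(ℝ, EuclideanSpace ℝ (Fin d))
      (fun s ↦ extChartAt (𝓡 d) p (γ s)) t _ := h1.hasMFDerivAt.comp t hγ.hasMFDerivAt
  have h3 : fieldCoord γ (fun s ↦ velocity (d := d) γ s) p t =
      mfderiv (𝓡 d) 𝓘(ℝ, EuclideanSpace ℝ (Fin d)) (extChartAt (𝓡 d) p) (γ t)
        (mfderiv 𝓘(ℝ, ℝ) (𝓡 d) γ t (1 : ℝ)) := by
    rw [← TangentBundle.continuousLinearMapAt_trivializationAt hp,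
      fieldCoord_eq _ (by simpa using hp), Trivialization.coe_continuousLinearEquivAt_eq]
    rfl
  obtain ⟨A, hA, hA1⟩ : ∃ A : ℝ →L[ℝ] EuclideanSpace ℝ (Fin d),
      HasFDerivAt (fun s ↦ extChartAt (𝓡 d) p (γ s)) A t ∧ A 1 =
        fieldCoord γ (fun s ↦ velocity (d := d) γ s) p t :=
    ⟨_, h2.hasFDerivAt, h3.symm⟩
  exact hA.hasDerivAt.congr_deriv hA1

end FieldCoordinates

/-! ### The pullback connection: restriction of vector fields and the chain rule. -/

section CovariantDerivativeAlong

variable {d : ℕ} {M : Type*} [TopologicalSpace M] [ChartedSpace (EuclideanSpace ℝ (Fin d)) M]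
  [IsManifold (𝓡 d) ∞ M]
  {E' H' : Type*} [NormedAddCommGroup E'] [NormedSpace ℝ E'] [TopologicalSpace H']
  {J : ModelWithCorners ℝ E' H'} {N : Type*} [TopologicalSpace N] [ChartedSpace H' N]

/-- The subtracted term is the flat connection of the trivialization at p. Two connections have the
same Leibniz term, so their difference depends only on the value of the section at p. -/
theorem tensorialAt_sub_fieldCoord (cov : TangentConnection d M) (p : M)
    (v : TangentSpace (𝓡 d) p) :
    TensorialAt (𝓡 d) (EuclideanSpace ℝ (Fin d))
      (fun σ : Π q : M, TangentSpace (𝓡 d) q ↦ cov σ p v -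
        (trivializationAt (EuclideanSpace ℝ (Fin d))
          (fun p : M ↦ TangentSpace (𝓡 d) p) p).symmL ℝ p
          (mvfderiv (𝓡 d) (sectionCoord σ p) p v)) p := by
  set e := trivializationAt (EuclideanSpace ℝ (Fin d)) (fun p : M ↦ TangentSpace (𝓡 d) p) p with he
  have hp := mem_trivializationAt_baseSet (d := d) p
  have hnhds := e.open_baseSet.mem_nhds hp
  refine ⟨fun {f σ} hf hσ ↦ ?_, fun {σ σ'} hσ hσ' ↦ ?_⟩
  · have hσc : MDifferentiableAt (𝓡 d) 𝓘(ℝ, EuclideanSpace ℝ (Fin d)) (sectionCoord σ p) p :=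
      (mdifferentiableAt_section _ σ).1 hσ
    have hev : sectionCoord (f • σ) p =ᶠ[𝓝 p] f • sectionCoord σ p := by
      filter_upwards [hnhds] with q hq
      simp only [Pi.smul_apply']
      rw [sectionCoord_eq _ hq, sectionCoord_eq _ hq]
      exact (e.continuousLinearEquivAt ℝ q hq).map_smul (f q) (σ q)
    have hd : mvfderiv (𝓡 d) (sectionCoord (f • σ) p) p v =
        f p • mvfderiv (𝓡 d) (sectionCoord σ p) p v +
          (mvfderiv (𝓡 d) f p v) • sectionCoord σ p p := by
      have : mvfderiv (𝓡 d) (sectionCoord (f • σ) p) p =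
        mvfderiv (𝓡 d) (f • sectionCoord σ p) p := by
        simp only [mvfderiv, hev.mfderiv_eq]
        rfl
      rw [this, mvfderiv_smul hf hσc]
      rfl
    have hs : e.symmL ℝ p (sectionCoord σ p p) = σ p := by
      exact symmL_sectionCoord σ hp
    rw [hd, cov.isCovariantDerivativeOn.leibniz (s := univ) hσ hf, map_add, map_smul, map_smul, hs]
    simp only [add_apply, smul_apply,
      ContinuousLinearMap.smulRight_apply, smul_sub]
    abel
  · have hσc : MDifferentiableAt (𝓡 d) 𝓘(ℝ, EuclideanSpace ℝ (Fin d)) (sectionCoord σ p) p :=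
      (mdifferentiableAt_section _ σ).1 hσ
    have hσc' : MDifferentiableAt (𝓡 d) 𝓘(ℝ, EuclideanSpace ℝ (Fin d)) (sectionCoord σ' p) p :=
      (mdifferentiableAt_section _ σ').1 hσ'
    have hev : sectionCoord (σ + σ') p =ᶠ[𝓝 p] sectionCoord σ p + sectionCoord σ' p := by
      filter_upwards [hnhds] with q hq
      simp only [Pi.add_apply]
      rw [sectionCoord_eq _ hq, sectionCoord_eq _ hq,
        sectionCoord_eq _ hq]
      exact (e.continuousLinearEquivAt ℝ q hq).map_add (σ q) (σ' q)
    have hd : mvfderiv (𝓡 d) (sectionCoord (σ + σ') p) p v =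
        mvfderiv (𝓡 d) (sectionCoord σ p) p v + mvfderiv (𝓡 d) (sectionCoord σ' p) p v := by
      have : mvfderiv (𝓡 d) (sectionCoord (σ + σ') p) p =
        mvfderiv (𝓡 d) (sectionCoord σ p + sectionCoord σ' p) p := by
        simp only [mvfderiv, hev.mfderiv_eq]
        rfl
      rw [this, mvfderiv_add hσc hσc']
      rfl
    rw [hd, cov.isCovariantDerivativeOn.add (s := univ) hσ hσ', map_add]
    simp only [add_apply]
    abel

/-- A connection in the trivialization at `p`. -/
theorem cov_apply_eq (cov : TangentConnection d M) {p : M}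
    {σ : Π q : M, TangentSpace (𝓡 d) q}
    (hσ : MDifferentiableAt (𝓡 d) (𝓡 d).tangent
      (fun q ↦ (⟨q, σ q⟩ : TangentBundle (𝓡 d) M)) p) (v : TangentSpace (𝓡 d) p) :
    cov σ p v = (trivializationAt (EuclideanSpace ℝ (Fin d))
          (fun p : M ↦ TangentSpace (𝓡 d) p) p).symmL ℝ p
        (mvfderiv (𝓡 d) (sectionCoord σ p) p v) +
      cov (FiberBundle.extend (EuclideanSpace ℝ (Fin d)) (σ p)) p v := by
  have hp := mem_trivializationAt_baseSet (d := d) p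
  have h := (tensorialAt_sub_fieldCoord cov p v).pointwise hσ
    (FiberBundle.mdifferentiableAt_extend (𝓡 d) (EuclideanSpace ℝ (Fin d)) (σ p))
    (FiberBundle.extend_apply_self (F := EuclideanSpace ℝ (Fin d)) (σ p)).symm
  -- The extension has constant coordinates, so its flat derivative vanishes and only the connection
  -- term remains.
  have h0 : mvfderiv (𝓡 d)
      (sectionCoord (FiberBundle.extend (EuclideanSpace ℝ (Fin d)) (σ p)) p) p = 0 := by
    have : sectionCoord (FiberBundle.extend (EuclideanSpace ℝ (Fin d)) (σ p)) p =ᶠ[𝓝 p]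
        fun _ ↦ (trivializationAt (EuclideanSpace ℝ (Fin d))
          (fun p : M ↦ TangentSpace (𝓡 d) p) p (⟨p, σ p⟩ : TangentBundle (𝓡 d) M)).2 := by
      filter_upwards [(Trivialization.open_baseSet _).mem_nhds hp] with q hq
      exact sectionCoord_extend (σ p) hq
    simp only [mvfderiv, this.mfderiv_eq]
    exact mvfderiv_const _
  simp only [h0] at h
  rw [sub_eq_iff_eq_add] at h
  rw [h, zero_apply, map_zero, sub_zero, add_comm]

theorem covAlong_apply (cov : TangentConnection d M) (f : N → M)
    (W : Π y : N, TangentSpace (𝓡 d) (f y)) (y : N) (v : TangentSpace J y) :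
    covAlong cov J f W y v = (trivializationAt (EuclideanSpace ℝ (Fin d))
          (fun p : M ↦ TangentSpace (𝓡 d) p) (f y)).symmL ℝ (f y)
        (mvfderiv J (fieldCoord f W (f y)) y v) +
      cov (FiberBundle.extend (EuclideanSpace ℝ (Fin d)) (W y)) (f y) (mfderiv J (𝓡 d) f y v) :=
  rfl

/-- The covariant derivative along `f` of the restriction of a vector field. -/
theorem covAlong_restrict (cov : TangentConnection d M) {f : N → M} {y : N}
    (hf : MDifferentiableAt J (𝓡 d) f y) {σ : Π q : M, TangentSpace (𝓡 d) q}
    (hσ : MDifferentiableAt (𝓡 d) (𝓡 d).tangent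
      (fun q ↦ (⟨q, σ q⟩ : TangentBundle (𝓡 d) M)) (f y)) (v : TangentSpace J y) :
    covAlong cov J f (fun z ↦ σ (f z)) y v = cov σ (f y) (mfderiv J (𝓡 d) f y v) := by
  have hσc : MDifferentiableAt (𝓡 d) 𝓘(ℝ, EuclideanSpace ℝ (Fin d))
      (sectionCoord σ (f y)) (f y) := (mdifferentiableAt_section _ σ).1 hσ
  have hc : fieldCoord f (fun z ↦ σ (f z)) (f y) = sectionCoord σ (f y) ∘ f := rfl
  have h : mvfderiv J (sectionCoord σ (f y) ∘ f) y v =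
      mvfderiv (𝓡 d) (sectionCoord σ (f y)) (f y) (mfderiv J (𝓡 d) f y v) :=
    mfderiv_comp_apply y hσc hf v
  rw [covAlong_apply, cov_apply_eq cov hσ, hc, h]

/-- The chain rule for the covariant derivative along a map. -/
theorem covAlong_comp (cov : TangentConnection d M)
    {E'' H'' : Type*} [NormedAddCommGroup E''] [NormedSpace ℝ E''] [TopologicalSpace H'']
    {J' : ModelWithCorners ℝ E'' H''} {N' : Type*} [TopologicalSpace N'] [ChartedSpace H'' N']
    {f : N → M} {c : N' → N} {t : N'} (hc : MDifferentiableAt J' J c t)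
    {W : Π y : N, TangentSpace (𝓡 d) (f y)}
    (hW : MDifferentiableAt J (𝓡 d).tangent
      (fun q ↦ (⟨f q, W q⟩ : TangentBundle (𝓡 d) M)) (c t)) (v : TangentSpace J' t) :
    covAlong cov J' (fun s ↦ f (c s)) (fun s ↦ W (c s)) t v =
      covAlong cov J f W (c t) (mfderiv J' J c t v) := by
  rw [mdifferentiableAt_totalSpace] at hW
  have hWc : MDifferentiableAt J 𝓘(ℝ, EuclideanSpace ℝ (Fin d))
    (fieldCoord f W (f (c t))) (c t) := hW.2
  have hf : MDifferentiableAt J (𝓡 d) f (c t) := hW.1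
  have h1 : fieldCoord (fun s ↦ f (c s)) (fun s ↦ W (c s)) (f (c t)) =
    fieldCoord f W (f (c t)) ∘ c := rfl
  have h2 : mfderiv J' (𝓡 d) (fun s ↦ f (c s)) t v =
      mfderiv J (𝓡 d) f (c t) (mfderiv J' J c t v) := mfderiv_comp_apply t hf hc v
  have h3 : mvfderiv J' (fieldCoord f W (f (c t)) ∘ c) t v =
      mvfderiv J (fieldCoord f W (f (c t))) (c t) (mfderiv J' J c t v) :=
    mfderiv_comp_apply t hWc hc v
  rw [covAlong_apply, covAlong_apply, h1, h3, h2]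

end CovariantDerivativeAlong

/-! ### The product rule for a metric connection along a curve. -/

section MetricAlong

variable {d : ℕ} {M : Type*} [TopologicalSpace M] [ChartedSpace (EuclideanSpace ℝ (Fin d)) M]
  [IsManifold (𝓡 d) ∞ M]
  {E' H' : Type*} [NormedAddCommGroup E'] [NormedSpace ℝ E'] [TopologicalSpace H']
  {J : ModelWithCorners ℝ E' H'} {N : Type*} [TopologicalSpace N] [ChartedSpace H' N]

theorem contMDiffAt_metric (g : ContMDiffRiemannianMetric (𝓡 d) ∞ (EuclideanSpace ℝ (Fin d))
    (fun p : M ↦ TangentSpace (𝓡 d) p)) {f : N → M} {W Z : Π y : N, TangentSpace (𝓡 d) (f y)}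
    {y : N}
    (hW : ContMDiffAt J (𝓡 d).tangent 1 (fun z ↦ (⟨f z, W z⟩ : TangentBundle (𝓡 d) M)) y)
    (hZ : ContMDiffAt J (𝓡 d).tangent 1 (fun z ↦ (⟨f z, Z z⟩ : TangentBundle (𝓡 d) M)) y) :
    ContMDiffAt J 𝓘(ℝ, ℝ) 1 (fun z ↦ g.inner (f z) (W z) (Z z)) y := by
  let _ : RiemannianBundle (fun p : M ↦ TangentSpace (𝓡 d) p) := ⟨g.toRiemannianMetric⟩
  have : IsContMDiffRiemannianBundle (𝓡 d) 1 (EuclideanSpace ℝ (Fin d))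
      (fun p : M ↦ TangentSpace (𝓡 d) p) :=
    ⟨g.inner, g.contMDiff.of_le (by norm_cast), fun _ _ _ ↦ rfl⟩
  exact ContMDiffAt.inner_bundle (E := fun p : M ↦ TangentSpace (𝓡 d) p) hW hZ

theorem mdifferentiableAt_metric (g : ContMDiffRiemannianMetric (𝓡 d) ∞ (EuclideanSpace ℝ (Fin d))
    (fun p : M ↦ TangentSpace (𝓡 d) p)) {f : N → M} {W Z : Π y : N, TangentSpace (𝓡 d) (f y)}
    {y : N}
    (hW : MDifferentiableAt J (𝓡 d).tangent (fun z ↦ (⟨f z, W z⟩ : TangentBundle (𝓡 d) M)) y)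
    (hZ : MDifferentiableAt J (𝓡 d).tangent (fun z ↦ (⟨f z, Z z⟩ : TangentBundle (𝓡 d) M)) y) :
    MDifferentiableAt J 𝓘(ℝ, ℝ) (fun z ↦ g.inner (f z) (W z) (Z z)) y := by
  let _ : RiemannianBundle (fun p : M ↦ TangentSpace (𝓡 d) p) := ⟨g.toRiemannianMetric⟩
  have : IsContMDiffRiemannianBundle (𝓡 d) 1 (EuclideanSpace ℝ (Fin d))
      (fun p : M ↦ TangentSpace (𝓡 d) p) :=
    ⟨g.inner, g.contMDiff.of_le (by norm_cast), fun _ _ _ ↦ rfl⟩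
  exact MDifferentiableAt.inner_bundle (E := fun p : M ↦ TangentSpace (𝓡 d) p) hW hZ

/-- Expand U in the local coordinate frame. At t the coefficients vanish, so neither the derivative
of the metric nor that of Z contributes; only the derivatives of the coefficients survive. -/
theorem hasDerivAt_metric_of_eq_zero
    (g : ContMDiffRiemannianMetric (𝓡 d) ∞ (EuclideanSpace ℝ (Fin d))
    (fun p : M ↦ TangentSpace (𝓡 d) p)) {γ : ℝ → M} {U Z : Π s : ℝ, TangentSpace (𝓡 d) (γ s)}
    {t : ℝ}
    (hU : MDifferentiableAt 𝓘(ℝ, ℝ) (𝓡 d).tangent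
      (fun z ↦ (⟨γ z, U z⟩ : TangentBundle (𝓡 d) M)) t)
    (hZ : MDifferentiableAt 𝓘(ℝ, ℝ) (𝓡 d).tangent
      (fun z ↦ (⟨γ z, Z z⟩ : TangentBundle (𝓡 d) M)) t) (h0 : U t = 0) :
    HasDerivAt (fun s ↦ g.inner (γ s) (U s) (Z s))
      (g.inner (γ t) ((trivializationAt (EuclideanSpace ℝ (Fin d))
        (fun p : M ↦ TangentSpace (𝓡 d) p) (γ t)).symmL ℝ (γ t)
          (deriv (fieldCoord γ U (γ t)) t)) (Z t)) t := by
  set e := trivializationAt (EuclideanSpace ℝ (Fin d)) (fun p : M ↦ TangentSpace (𝓡 d) p) (γ t)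
    with he
  set u := fieldCoord γ U (γ t) with hu
  obtain ⟨hγ, huc⟩ := mdifferentiableAt_field_iff.1 hU
  have hp := mem_trivializationAt_baseSet (d := d) (γ t)
  have hub : HasDerivAt u (deriv u t) t :=
    (mdifferentiableAt_iff_differentiableAt.1 huc).hasDerivAt
  have hu0 : u t = 0 := by
    rw [hu, fieldCoord_eq _ hp, h0]
    exact map_zero _
  let b := EuclideanSpace.basisFun (Fin d) ℝ
  let σ : Fin d → Π q : M, TangentSpace (𝓡 d) q := fun i ↦
    FiberBundle.extend (EuclideanSpace ℝ (Fin d)) (e.symmL ℝ (γ t) (b i))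
  have hσ : ∀ i, ∀ q ∈ e.baseSet, σ i q = e.symmL ℝ q (b i) := by
    intro i q hq
    have h1 : sectionCoord (σ i) (γ t) q = b i := by
      rw [sectionCoord_extend _ hq]
      rw [Trivialization.symmL_apply (hb := hp)]
      exact congrArg Prod.snd (e.apply_mk_symm hp (b i))
    rw [← h1, symmL_sectionCoord _ hq]
  have hσd : ∀ i, MDifferentiableAt 𝓘(ℝ, ℝ) (𝓡 d).tangent
      (fun s ↦ (⟨γ s, σ i (γ s)⟩ : TangentBundle (𝓡 d) M)) t := fun i ↦
    (FiberBundle.mdifferentiableAt_extend (𝓡 d) (EuclideanSpace ℝ (Fin d)) _).comp t hγ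
  have hev : (fun s ↦ g.inner (γ s) (U s) (Z s)) =ᶠ[𝓝 t]
      fun s ↦ ∑ i, u s i * g.inner (γ s) (σ i (γ s)) (Z s) := by
    filter_upwards [eventually_mem_baseSet (d := d) hγ.continuousAt] with s hs
    have h2 : U s = ∑ i, u s i • σ i (γ s) := by
      rw [← symmL_fieldCoord U hs]
      conv_lhs => rw [← b.sum_repr (fieldCoord γ U (γ t) s)]
      rw [map_sum]
      refine Finset.sum_congr rfl fun i _ ↦ ?_
      rw [hσ i _ hs, map_smul]
      rfl
    rw [h2, map_sum, sum_apply]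
    refine Finset.sum_congr rfl fun i _ ↦ ?_
    rw [map_smul]
    rfl
  have hh : ∀ i, DifferentiableAt ℝ (fun s ↦ g.inner (γ s) (σ i (γ s)) (Z s)) t := fun i ↦
    mdifferentiableAt_iff_differentiableAt.1
      (mdifferentiableAt_metric g (W := fun s ↦ σ i (γ s)) (hσd i) hZ)
  have hui : ∀ i, HasDerivAt (fun s ↦ u s i) (deriv u t i) t := fun i ↦
    (EuclideanSpace.proj (𝕜 := ℝ) i).hasFDerivAt.comp_hasDerivAt t hub
  refine HasDerivAt.congr_of_eventuallyEq ?_ hev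
  refine (HasDerivAt.fun_sum fun i _ ↦ (hui i).mul (hh i).hasDerivAt).congr_deriv ?_
  have h3 : e.symmL ℝ (γ t) (deriv u t) = ∑ i, deriv u t i • σ i (γ t) := by
    conv_lhs => rw [← b.sum_repr (deriv u t)]
    rw [map_sum]
    refine Finset.sum_congr rfl fun i _ ↦ ?_
    rw [hσ i _ hp, map_smul]
    rfl
  rw [h3, map_sum, sum_apply]
  refine Finset.sum_congr rfl fun i _ ↦ ?_
  rw [hu0, map_smul]
  simp

theorem covAlong_curve_apply (cov : TangentConnection d M) (γ : ℝ → M)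
    (W : Π s : ℝ, TangentSpace (𝓡 d) (γ s)) (t : ℝ) :
    covAlong cov 𝓘(ℝ, ℝ) γ W t (1 : ℝ) = (trivializationAt (EuclideanSpace ℝ (Fin d))
          (fun p : M ↦ TangentSpace (𝓡 d) p) (γ t)).symmL ℝ (γ t)
        (deriv (fieldCoord γ W (γ t)) t) +
      cov (FiberBundle.extend (EuclideanSpace ℝ (Fin d)) (W t)) (γ t)
        (mfderiv 𝓘(ℝ, ℝ) (𝓡 d) γ t (1 : ℝ)) := by
  have h : (mvfderiv 𝓘(ℝ, ℝ) (fieldCoord γ W (γ t)) t (1 : ℝ) : EuclideanSpace ℝ (Fin d)) =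
      deriv (fieldCoord γ W (γ t)) t := by
    rw [← fderiv_apply_one_eq_deriv, mvfderiv, mfderiv_eq_fderiv]
    rfl
  rw [← h]
  rfl

/-- The product rule for the metric and a metric connection along a curve. -/
theorem hasDerivAt_metric_along
    (g : ContMDiffRiemannianMetric (𝓡 d) ∞ (EuclideanSpace ℝ (Fin d))
      (fun p : M ↦ TangentSpace (𝓡 d) p)) (cov : TangentConnection d M)
    (hcompat : letI : RiemannianBundle (fun p : M ↦ TangentSpace (𝓡 d) p) := ⟨g.toRiemannianMetric⟩
      haveI : IsContMDiffRiemannianBundle (𝓡 d) ∞ (EuclideanSpace ℝ (Fin d))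
        (fun p : M ↦ TangentSpace (𝓡 d) p) := ⟨g.inner, g.contMDiff, fun _ _ _ ↦ rfl⟩
      cov.IsMetricCompatible)
    {γ : ℝ → M} {W Z : Π s : ℝ, TangentSpace (𝓡 d) (γ s)} {t : ℝ}
    (hW : MDifferentiableAt 𝓘(ℝ, ℝ) (𝓡 d).tangent
      (fun z ↦ (⟨γ z, W z⟩ : TangentBundle (𝓡 d) M)) t)
    (hZ : MDifferentiableAt 𝓘(ℝ, ℝ) (𝓡 d).tangent
      (fun z ↦ (⟨γ z, Z z⟩ : TangentBundle (𝓡 d) M)) t) :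
    HasDerivAt (fun s ↦ g.inner (γ s) (W s) (Z s))
      (g.inner (γ t) (covAlong cov 𝓘(ℝ, ℝ) γ W t (1 : ℝ)) (Z t) +
        g.inner (γ t) (W t) (covAlong cov 𝓘(ℝ, ℝ) γ Z t (1 : ℝ))) t := by
  obtain ⟨hγ, hWc⟩ := mdifferentiableAt_field_iff.1 hW
  obtain ⟨-, hZc⟩ := mdifferentiableAt_field_iff.1 hZ
  set F := EuclideanSpace ℝ (Fin d)
  set e := trivializationAt F (fun p : M ↦ TangentSpace (𝓡 d) p) (γ t) with he
  have hp := mem_trivializationAt_baseSet (d := d) (γ t)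
  let σ : TangentSpace (𝓡 d) (γ t) → Π q : M, TangentSpace (𝓡 d) q := fun u ↦
    FiberBundle.extend F u
  have hσ0 : ∀ u, σ u (γ t) = u := fun u ↦ FiberBundle.extend_apply_self (F := F) u
  have hσm : ∀ u, MDifferentiableAt (𝓡 d) (𝓡 d).tangent
      (fun q ↦ (⟨q, σ u q⟩ : TangentBundle (𝓡 d) M)) (γ t) := fun u ↦
    FiberBundle.mdifferentiableAt_extend (𝓡 d) F u
  have hσd : ∀ u, MDifferentiableAt 𝓘(ℝ, ℝ) (𝓡 d).tangent
      (fun s ↦ (⟨γ s, σ u (γ s)⟩ : TangentBundle (𝓡 d) M)) t := fun u ↦ (hσm u).comp t hγ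
  have hbase := eventually_mem_baseSet (d := d) hγ.continuousAt
  -- Subtracting the extension of X t makes the field vanish at t and changes its coordinates only
  -- by a constant.
  have key : ∀ X : Π s : ℝ, TangentSpace (𝓡 d) (γ s),
      MDifferentiableAt 𝓘(ℝ, ℝ) (𝓡 d).tangent
        (fun z ↦ (⟨γ z, X z⟩ : TangentBundle (𝓡 d) M)) t →
      MDifferentiableAt 𝓘(ℝ, ℝ) (𝓡 d).tangent
        (fun z ↦ (⟨γ z, X z - σ (X t) (γ z)⟩ : TangentBundle (𝓡 d) M)) t ∧
      deriv (fieldCoord γ (fun z ↦ X z - σ (X t) (γ z)) (γ t)) t =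
        deriv (fieldCoord γ X (γ t)) t := by
    intro X hX
    obtain ⟨-, hXc⟩ := mdifferentiableAt_field_iff.1 hX
    have hev : fieldCoord γ (fun z ↦ X z - σ (X t) (γ z)) (γ t) =ᶠ[𝓝 t]
        fun s ↦ fieldCoord γ X (γ t) s - (e (⟨γ t, X t⟩ : TangentBundle (𝓡 d) M)).2 := by
      filter_upwards [hbase] with s hs
      have h1 : sectionCoord (σ (X t)) (γ t) (γ s) =
        (e (⟨γ t, X t⟩ : TangentBundle (𝓡 d) M)).2 := sectionCoord_extend _ hs
      rw [← h1, sectionCoord_eq _ hs, fieldCoord_eq _ hs, fieldCoord_eq _ hs]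
      exact map_sub _ _ _
    have hd := mdifferentiableAt_iff_differentiableAt.1 hXc
    refine ⟨mdifferentiableAt_field_iff.2 ⟨hγ, ?_⟩, ?_⟩
    · refine mdifferentiableAt_iff_differentiableAt.2 ?_
      exact DifferentiableAt.congr_of_eventuallyEq (hd.sub_const _) hev
    · rw [hev.deriv_eq, deriv_sub_const]
  obtain ⟨hU1, hU1d⟩ := key W hW
  obtain ⟨hU2, hU2d⟩ := key Z hZ
  -- With bars for the extensions of the values at t, ⟨W, Z⟩ = ⟨W - W̄, Z⟩ + ⟨Z - Z̄, W̄⟩ + ⟨W̄,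
  -- Z̄⟩. The first two terms have a factor vanishing at t; the last is a function on M, to which
  -- compatibility of the connection applies.
  have h1 := hasDerivAt_metric_of_eq_zero g hU1 hZ (by rw [hσ0, sub_self])
  have h2 := hasDerivAt_metric_of_eq_zero g hU2 (hσd (W t)) (by rw [hσ0, sub_self])
  have h3 : HasDerivAt (fun s ↦ g.inner (γ s) (σ (W t) (γ s)) (σ (Z t) (γ s)))
      (g.inner (γ t) (cov (σ (W t)) (γ t) (mfderiv 𝓘(ℝ, ℝ) (𝓡 d) γ t (1 : ℝ))) (Z t) +
        g.inner (γ t) (W t) (cov (σ (Z t)) (γ t) (mfderiv 𝓘(ℝ, ℝ) (𝓡 d) γ t (1 : ℝ)))) t := by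
    have hm : MDifferentiableAt (𝓡 d) 𝓘(ℝ, ℝ)
        (fun q ↦ g.inner q (σ (W t) q) (σ (Z t) q)) (γ t) :=
      mdifferentiableAt_metric g (f := fun q ↦ q) (hσm _) (hσm _)
    have hc : mfderiv (𝓡 d) 𝓘(ℝ, ℝ) (fun q ↦ g.inner q (σ (W t) q) (σ (Z t) q)) (γ t)
        (mfderiv 𝓘(ℝ, ℝ) (𝓡 d) γ t (1 : ℝ)) =
        (g.inner (γ t) (cov (σ (W t)) (γ t) (mfderiv 𝓘(ℝ, ℝ) (𝓡 d) γ t (1 : ℝ))) (Z t) +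
        g.inner (γ t) (W t) (cov (σ (Z t)) (γ t) (mfderiv 𝓘(ℝ, ℝ) (𝓡 d) γ t (1 : ℝ))) : ℝ) := by
      let _ : RiemannianBundle (fun p : M ↦ TangentSpace (𝓡 d) p) := ⟨g.toRiemannianMetric⟩
      have : IsContMDiffRiemannianBundle (𝓡 d) ∞ F
        (fun p : M ↦ TangentSpace (𝓡 d) p) := ⟨g.inner, g.contMDiff, fun _ _ _ ↦ rfl⟩
      have h := CovariantDerivative.IsMetricCompatible.mvfderiv_inner_eq (cov := cov) hcompat
        (FiberBundle.extend F (mfderiv 𝓘(ℝ, ℝ) (𝓡 d) γ t (1 : ℝ))) (hσm (W t)) (hσm (Z t))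
      beta_reduce at h
      rw [FiberBundle.extend_apply_self, hσ0, hσ0] at h
      exact h
    have hcomp : HasMFDerivAt 𝓘(ℝ, ℝ) 𝓘(ℝ, ℝ)
      (fun s ↦ g.inner (γ s) (σ (W t) (γ s)) (σ (Z t) (γ s))) t _ :=
      hm.hasMFDerivAt.comp t hγ.hasMFDerivAt
    obtain ⟨A, hA, hA1⟩ : ∃ A : ℝ →L[ℝ] ℝ,
        HasFDerivAt (fun s ↦ g.inner (γ s) (σ (W t) (γ s)) (σ (Z t) (γ s))) A t ∧ A 1 = _ :=
      ⟨_, hcomp.hasFDerivAt, hc⟩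
    exact hA.hasDerivAt.congr_deriv hA1
  have h4 := (h1.add h2).add h3
  refine (h4.congr_deriv ?_).congr_of_eventuallyEq ?_
  · have hW1 := covAlong_curve_apply cov γ W t
    have hZ1 := covAlong_curve_apply cov γ Z t
    rw [hW1, hZ1, hU1d, hU2d, hσ0]
    rw [g.symm (γ t) _ (W t), map_add, map_add, add_apply]
    ring
  · refine Filter.Eventually.of_forall fun s ↦ ?_
    simp only [Pi.add_apply]
    rw [g.symm (γ s) _ (σ (W t) (γ s)), map_sub, map_sub, sub_apply]
    ring

end MetricAlong

/-! ### Linear operations on fields along a map. -/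

section FieldAlgebra

variable {d : ℕ} {M : Type*} [TopologicalSpace M] [ChartedSpace (EuclideanSpace ℝ (Fin d)) M]
  [IsManifold (𝓡 d) 1 M]
  {E' H' : Type*} [NormedAddCommGroup E'] [NormedSpace ℝ E'] [TopologicalSpace H']
  {J : ModelWithCorners ℝ E' H'} {N : Type*} [TopologicalSpace N] [ChartedSpace H' N]

theorem contMDiffAt_field_sub {f : N → M} {W Z : Π y : N, TangentSpace (𝓡 d) (f y)} {y : N}
    {k : WithTop ℕ∞}
    (hW : ContMDiffAt J (𝓡 d).tangent k (fun z ↦ (⟨f z, W z⟩ : TangentBundle (𝓡 d) M)) y)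
    (hZ : ContMDiffAt J (𝓡 d).tangent k (fun z ↦ (⟨f z, Z z⟩ : TangentBundle (𝓡 d) M)) y) :
    ContMDiffAt J (𝓡 d).tangent k (fun z ↦ (⟨f z, W z - Z z⟩ : TangentBundle (𝓡 d) M)) y := by
  obtain ⟨hf, hWc⟩ := contMDiffAt_field_iff.1 hW
  obtain ⟨-, hZc⟩ := contMDiffAt_field_iff.1 hZ
  refine contMDiffAt_field_iff.2 ⟨hf, (hWc.sub hZc).congr_of_eventuallyEq ?_⟩
  filter_upwards [eventually_mem_baseSet (d := d) hf.continuousAt] with z hz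
  rw [fieldCoord_eq _ hz, fieldCoord_eq _ hz, fieldCoord_eq _ hz]
  exact map_sub _ _ _

theorem contMDiffAt_field_smul {f : N → M} {a : N → ℝ} {W : Π y : N, TangentSpace (𝓡 d) (f y)}
    {y : N} {k : WithTop ℕ∞} (ha : ContMDiffAt J 𝓘(ℝ, ℝ) k a y)
    (hW : ContMDiffAt J (𝓡 d).tangent k (fun z ↦ (⟨f z, W z⟩ : TangentBundle (𝓡 d) M)) y) :
    ContMDiffAt J (𝓡 d).tangent k (fun z ↦ (⟨f z, a z • W z⟩ : TangentBundle (𝓡 d) M)) y := by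
  obtain ⟨hf, hWc⟩ := contMDiffAt_field_iff.1 hW
  refine contMDiffAt_field_iff.2 ⟨hf, (ha.smul hWc).congr_of_eventuallyEq ?_⟩
  filter_upwards [eventually_mem_baseSet (d := d) hf.continuousAt] with z hz
  rw [fieldCoord_eq _ hz]
  simp only [Pi.smul_apply']
  rw [fieldCoord_eq _ hz]
  exact map_smul _ _ _

instance instFiniteDimensionalTangentSpace (p : M) :
    FiniteDimensional ℝ (TangentSpace (𝓡 d) p) :=
  inferInstanceAs (FiniteDimensional ℝ (EuclideanSpace ℝ (Fin d)))

omit [IsManifold (𝓡 d) 1 M] in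
theorem finrank_tangentSpace (p : M) : Module.finrank ℝ (TangentSpace (𝓡 d) p) = d :=
  finrank_euclideanSpace_fin

end FieldAlgebra

theorem exists_ne_zero_mem_inf {E : Type*} [AddCommGroup E] [Module ℝ E] [FiniteDimensional ℝ E]
    {H T : Submodule ℝ E}
    (h : Module.finrank ℝ E < Module.finrank ℝ H + Module.finrank ℝ T) :
    ∃ u ∈ H ⊓ T, u ≠ 0 := by
  by_contra! hc
  have h0 : H ⊓ T = ⊥ := (Submodule.eq_bot_iff _).2 hc
  have h1 := Submodule.finrank_sup_add_finrank_inf_eq H T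
  rw [h0, finrank_bot] at h1
  have h2 := Submodule.finrank_le (H ⊔ T)
  omega

/-! ### Pointwise linear algebra of the metric. -/

section Metric

variable {d : ℕ} {M : Type*} [TopologicalSpace M] [ChartedSpace (EuclideanSpace ℝ (Fin d)) M]
  [IsManifold (𝓡 d) ∞ M]
  (g : ContMDiffRiemannianMetric (𝓡 d) ∞ (EuclideanSpace ℝ (Fin d))
    (fun p : M ↦ TangentSpace (𝓡 d) p))

theorem metric_smul_left (p : M) (a : ℝ) (u v : TangentSpace (𝓡 d) p) :
    g.inner p (a • u) v = a * g.inner p u v := by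
  rw [map_smul]; rfl

theorem metric_smul_right (p : M) (a : ℝ) (u v : TangentSpace (𝓡 d) p) :
    g.inner p u (a • v) = a * g.inner p u v := by
  rw [map_smul]; rfl

theorem metric_add_left (p : M) (u w v : TangentSpace (𝓡 d) p) :
    g.inner p (u + w) v = g.inner p u v + g.inner p w v := by
  rw [map_add]; rfl

theorem metric_sub_left (p : M) (u w v : TangentSpace (𝓡 d) p) :
    g.inner p (u - w) v = g.inner p u v - g.inner p w v := by
  rw [map_sub]; rfl

theorem metric_self_pos {p : M} {u : TangentSpace (𝓡 d) p} (h : u ≠ 0) : 0 < g.inner p u u :=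
  g.pos p u h

theorem metric_normalize {p : M} {u : TangentSpace (𝓡 d) p} (h : u ≠ 0) :
    g.inner p ((√(g.inner p u u))⁻¹ • u) ((√(g.inner p u u))⁻¹ • u) = 1 := by
  have h1 := metric_self_pos g h
  rw [metric_smul_left, metric_smul_right, ← mul_assoc, ← mul_inv, Real.mul_self_sqrt h1.le,
    inv_mul_cancel₀ h1.ne']

theorem eq_of_mem_plane {p : M} {H : Submodule ℝ (TangentSpace (𝓡 d) p)}
    (hH : Module.finrank ℝ H = 2) {u v w : TangentSpace (𝓡 d) p} (hu : u ∈ H) (hv : v ∈ H)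
    (hw : w ∈ H) (huu : g.inner p u u = 1) (hvv : g.inner p v v = 1) (huv : g.inner p u v = 0) :
    w = g.inner p w u • u + g.inner p w v • v := by
  have hvu : g.inner p v u = 0 := by rw [g.symm, huv]
  have hli : LinearIndependent ℝ ![u, v] := by
    rw [LinearIndependent.pair_iff]
    intro s t hst
    have h1 : g.inner p (s • u + t • v) u = 0 := by rw [hst, map_zero]; rfl
    have h2 : g.inner p (s • u + t • v) v = 0 := by rw [hst, map_zero]; rfl
    rw [metric_add_left, metric_smul_left, metric_smul_left, huu, hvu] at h1
    rw [metric_add_left, metric_smul_left, metric_smul_left, huv, hvv] at h2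
    exact ⟨by linarith, by linarith⟩
  have hfr := finrank_span_eq_card hli
  rw [Fintype.card_fin, Matrix.range_cons, Matrix.range_cons, Matrix.range_empty, union_empty] at hfr
  have hle : Submodule.span ℝ ({u} ∪ {v}) ≤ H := by
    rw [Submodule.span_le]
    rintro x (rfl | rfl) <;> assumption
  have heq := Submodule.eq_of_le_of_finrank_eq hle (by rw [hfr, hH])
  rw [← heq, singleton_union, Submodule.mem_span_pair] at hw
  obtain ⟨a, b, rfl⟩ := hw
  rw [metric_add_left, metric_smul_left, metric_smul_left, huu, hvu, metric_add_left,
    metric_smul_left, metric_smul_left, huv, hvv]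
  simp

end Metric

/-! ### The horizontal tangent line of a noncharacteristic patch. -/

section Patch

variable {n : ℕ} {M : Type*} [TopologicalSpace M]
  [ChartedSpace (EuclideanSpace ℝ (Fin (n + 1))) M] [IsManifold (𝓡 (n + 1)) ∞ M]
  {S : SubRiemannianStructure (n + 1) M} {V : VerticallyRigidStructure S}
  {P : Type*} [TopologicalSpace P]
  [ChartedSpace (EuclideanSpace ℝ (Fin n)) P] [IsManifold (𝓡 n) 2 P]
  {ι : P → M} {ν : (x : P) → TangentSpace (𝓡 (n + 1)) (ι x)}

/-- The normal N and ν differ by a vertical vector, which horizontal vectors do not see. -/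
theorem metric_normal_eq_zero (hp : IsNoncharacteristicPatch (n := n) V ι ν) {x : P}
    {u : TangentSpace (𝓡 (n + 1)) (ι x)} (hu : u ∈ S.horizontal (ι x))
    (hut : u ∈ tangentImage (n := n) ι x) : V.metric.inner (ι x) u (ν x) = 0 := by
  obtain ⟨N, hN, hNν⟩ := hp.normal_projection x
  have h1 := hN u hut
  have h2 := V.metric_orthogonal (ι x) u hu _ hNν
  rw [map_sub, V.metric.symm _ u N, h1] at h2
  linarith

theorem finrank_tangentImage (hp : IsNoncharacteristicPatch (n := n) V ι ν) (x : P) :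
    Module.finrank ℝ (tangentImage (d := n + 1) (n := n) ι x) = n := by
  have h := LinearMap.finrank_range_of_inj (f := (mfderiv (𝓡 n) (𝓡 (n + 1)) ι x).toLinearMap)
    (hp.immersive x)
  refine h.trans ?_
  exact finrank_tangentSpace (d := n) x

theorem exists_unit_mem_inf (hrank : S.rank = 2) (hp : IsNoncharacteristicPatch (n := n) V ι ν)
    (x : P) : ∃ u ∈ S.horizontal (ι x) ⊓ tangentImage (n := n) ι x,
      V.metric.inner (ι x) u u = 1 := by
  obtain ⟨u, hu, hu0⟩ := exists_ne_zero_mem_inf (H := S.horizontal (ι x))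
    (T := tangentImage (n := n) ι x) (by
      rw [finrank_tangentImage hp, S.finrank_horizontal, hrank, finrank_tangentSpace]; omega)
  exact ⟨_, Submodule.smul_mem _ _ hu, metric_normalize V.metric hu0⟩

/-- In the plane V₀ the orthogonal complement of ν is a line, and the dimension count already
provides a tangent unit vector on it. -/
theorem mem_tangentImage_of_metric_normal_eq_zero (hrank : S.rank = 2)
    (hp : IsNoncharacteristicPatch (n := n) V ι ν) {x : P}
    {u : TangentSpace (𝓡 (n + 1)) (ι x)} (hu : u ∈ S.horizontal (ι x))
    (huν : V.metric.inner (ι x) u (ν x) = 0) : u ∈ tangentImage (n := n) ι x := by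
  obtain ⟨w, ⟨hw, hwt⟩, hww⟩ := exists_unit_mem_inf hrank hp x
  have h := eq_of_mem_plane V.metric (by rw [S.finrank_horizontal, hrank]) hw
    (hp.normal_horizontal x) hu hww (hp.normal_unit x) (metric_normal_eq_zero hp hw hwt)
  rw [huν, zero_smul, add_zero] at h
  rw [h]
  exact Submodule.smul_mem _ _ hwt

/-- Locally, the horizontal unit field orthogonal to `ν` can be chosen `C¹`. -/
theorem exists_local_unit_field (hrank : S.rank = 2)
    (hp : IsNoncharacteristicPatch (n := n) V ι ν) (x₀ : P) :
    ∃ w : (x : P) → TangentSpace (𝓡 (n + 1)) (ι x), ∀ᶠ x in 𝓝 x₀,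
      ContMDiffAt (𝓡 n) (𝓡 (n + 1)).tangent 1
        (fun x ↦ (⟨ι x, w x⟩ : TangentBundle (𝓡 (n + 1)) M)) x ∧
      w x ∈ S.horizontal (ι x) ∧ V.metric.inner (ι x) (w x) (w x) = 1 ∧
      V.metric.inner (ι x) (w x) (ν x) = 0 := by
  obtain ⟨U, hU, hxU, X, hX, hspan⟩ := S.exists_smooth_frame (ι x₀)
  -- Local frame fields of V₀ projected orthogonally to ν.
  let w₀ : Fin S.rank → (x : P) → TangentSpace (𝓡 (n + 1)) (ι x) := fun i x ↦
    X i (ι x) - V.metric.inner (ι x) (X i (ι x)) (ν x) • ν x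
  have hι := hp.contMDiff
  have hev : ∀ᶠ x in 𝓝 x₀, ι x ∈ U := hι.continuous.continuousAt.eventually (hU.mem_nhds hxU)
  have hXm : ∀ i x, ι x ∈ U → ContMDiffAt (𝓡 n) (𝓡 (n + 1)).tangent 1
        (fun x ↦ (⟨ι x, X i (ι x)⟩ : TangentBundle (𝓡 (n + 1)) M)) x := by
    intro i x hx
    have h1 : ContMDiffAt (𝓡 (n + 1)) (𝓡 (n + 1)).tangent 1
        (fun q ↦ (⟨q, X i q⟩ : TangentBundle (𝓡 (n + 1)) M)) (ι x) :=
      ((hX i).contMDiffAt (hU.mem_nhds hx)).of_le (by norm_cast)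
    exact h1.comp x ((hι x).of_le (by norm_num))
  have hw₀ : ∀ i x, ι x ∈ U → ContMDiffAt (𝓡 n) (𝓡 (n + 1)).tangent 1
        (fun x ↦ (⟨ι x, w₀ i x⟩ : TangentBundle (𝓡 (n + 1)) M)) x := fun i x hx ↦
    contMDiffAt_field_sub (hXm i x hx) (contMDiffAt_field_smul
      (contMDiffAt_metric V.metric (hXm i x hx) (hp.normal_contMDiff x)) (hp.normal_contMDiff x))
  -- If every projection vanished at x₀, the plane V₀ would lie in the line spanned by ν.
  obtain ⟨i, hi⟩ : ∃ i, w₀ i x₀ ≠ 0 := by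
    by_contra! hc
    have hle : S.horizontal (ι x₀) ≤ Submodule.span ℝ {ν x₀} := by
      rw [← hspan _ hxU, Submodule.span_le]
      rintro _ ⟨i, rfl⟩
      have := sub_eq_zero.1 (hc i)
      beta_reduce
      rw [SetLike.mem_coe, this]
      exact Submodule.smul_mem _ _ (Submodule.mem_span_singleton_self _)
    have h1 := Submodule.finrank_mono hle
    rw [S.finrank_horizontal, hrank] at h1
    have h2 := finrank_span_le_card (R := ℝ) ({ν x₀} : Set (TangentSpace (𝓡 (n + 1)) (ι x₀)))
    simp only [toFinset_singleton, Finset.card_singleton] at h2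
    omega
  refine ⟨fun x ↦ (√(V.metric.inner (ι x) (w₀ i x) (w₀ i x)))⁻¹ • w₀ i x, ?_⟩
  have hpos : ∀ᶠ x in 𝓝 x₀, 0 < V.metric.inner (ι x) (w₀ i x) (w₀ i x) := by
    have := (contMDiffAt_metric V.metric (hw₀ i x₀ hxU) (hw₀ i x₀ hxU)).continuousAt
    exact this.eventually (lt_mem_nhds (metric_self_pos V.metric hi))
  filter_upwards [hev, hpos] with x hx hx0
  have hne : w₀ i x ≠ 0 := by
    intro h
    rw [h, map_zero] at hx0
    exact lt_irrefl _ hx0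
  refine ⟨?_, ?_, metric_normalize V.metric hne, ?_⟩
  · refine contMDiffAt_field_smul ?_ (hw₀ i x hx)
    have h1 := contMDiffAt_metric V.metric (hw₀ i x hx) (hw₀ i x hx)
    have h2 : ContDiffAt ℝ 1 (fun r : ℝ ↦ (√r)⁻¹) (V.metric.inner (ι x) (w₀ i x) (w₀ i x)) :=
      (Real.contDiffAt_sqrt hx0.ne').inv (Real.sqrt_ne_zero'.2 hx0)
    exact ContMDiffAt.comp (g := fun r : ℝ ↦ (√r)⁻¹) x h2.contMDiffAt h1
  · refine Submodule.smul_mem _ _ (Submodule.sub_mem _ ?_ (Submodule.smul_mem _ _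
      (hp.normal_horizontal x)))
    rw [← hspan _ hx]
    exact Submodule.subset_span ⟨i, rfl⟩
  · have h0 : V.metric.inner (ι x) (w₀ i x) (ν x) = 0 := by
      rw [metric_sub_left, metric_smul_left, hp.normal_unit]
      ring
    rw [metric_smul_left, h0, mul_zero]

end Patch

/-! ### Regularity of lifts through an immersion. -/

section Lift

variable {d n : ℕ} {M : Type*} [TopologicalSpace M]
  [ChartedSpace (EuclideanSpace ℝ (Fin d)) M] [IsManifold (𝓡 d) 2 M]
  {P : Type*} [TopologicalSpace P]
  [ChartedSpace (EuclideanSpace ℝ (Fin n)) P] [IsManifold (𝓡 n) 2 P]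
  {ι : P → M}

/-- A lift of a `C¹` field along an immersion to the source of the immersion is `C¹`. -/
theorem contMDiffAt_lift (hι : ContMDiff (𝓡 n) (𝓡 d) 2 ι) {y : P}
    (hinj : Function.Injective (mfderiv (𝓡 n) (𝓡 d) ι y))
    {w : (x : P) → TangentSpace (𝓡 d) (ι x)} {v : (x : P) → TangentSpace (𝓡 n) x}
    (hw : ContMDiffAt (𝓡 n) (𝓡 d).tangent 1 (fun x ↦ (⟨ι x, w x⟩ : TangentBundle (𝓡 d) M)) y)
    (hv : ∀ᶠ x in 𝓝 y, mfderiv (𝓡 n) (𝓡 d) ι x (v x) = w x) :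
    ContMDiffAt (𝓡 n) (𝓡 n).tangent 1 (fun x ↦ (⟨x, v x⟩ : TangentBundle (𝓡 n) P)) y := by
  set eP := trivializationAt (EuclideanSpace ℝ (Fin n)) (fun p : P ↦ TangentSpace (𝓡 n) p) y
  set eM := trivializationAt (EuclideanSpace ℝ (Fin d)) (fun p : M ↦ TangentSpace (𝓡 d) p) (ι y)
  set D := inTangentCoordinates (𝓡 n) (𝓡 d) id ι (mfderiv (𝓡 n) (𝓡 d) ι) y with hDdef
  have hD : ContMDiffAt (𝓡 n) 𝓘(ℝ, EuclideanSpace ℝ (Fin n) →L[ℝ] EuclideanSpace ℝ (Fin d)) 1 D y :=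
    (hι y).mfderiv_const (by norm_num)
  have hDapply : ∀ x u, D x u = eM.continuousLinearMapAt ℝ (ι x)
      (mfderiv (𝓡 n) (𝓡 d) ι x (eP.symmL ℝ x u)) := fun x u ↦ rfl
  obtain ⟨-, hwc⟩ := contMDiffAt_field_iff.1 hw
  have hyP : y ∈ eP.baseSet := mem_trivializationAt_baseSet y
  have hyM : ι y ∈ eM.baseSet := mem_trivializationAt_baseSet (ι y)
  have hev : ∀ᶠ x in 𝓝 y, D x (sectionCoord v y x) = fieldCoord ι w (ι y) x := by
    filter_upwards [hv, eP.open_baseSet.mem_nhds hyP,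
      eventually_mem_baseSet (d := d) hι.continuous.continuousAt] with x hx hxP hxM
    rw [hDapply, symmL_sectionCoord _ hxP, hx, fieldCoord_eq _ hxM,
      Trivialization.coe_continuousLinearEquivAt_eq]
  have hDinj : LinearMap.ker (D y).toLinearMap = ⊥ := by
    rw [LinearMap.ker_eq_bot]
    intro a b hab
    change D y a = D y b at hab
    rw [hDapply, hDapply, ← Trivialization.coe_continuousLinearEquivAt_eq _ hyM] at hab
    have h1 := hinj ((eM.continuousLinearEquivAt ℝ (ι y) hyM).injective hab)
    rw [← Trivialization.symm_continuousLinearEquivAt_eq _ hyP] at h1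
    exact (eP.continuousLinearEquivAt ℝ y hyP).symm.injective h1
  -- D is dι in coordinates, of class C¹ because ι is C². With L a left inverse of D at y, the
  -- operator L ∘ D is the identity at y, hence invertible nearby, and the lift is (L ∘ D)⁻¹ L w.
  obtain ⟨L, hL⟩ := LinearMap.exists_leftInverse_of_injective _ hDinj
  let A : P → EuclideanSpace ℝ (Fin n) →L[ℝ] EuclideanSpace ℝ (Fin n) := fun x ↦
    (LinearMap.toContinuousLinearMap L).comp (D x)
  have hA : ContMDiffAt (𝓡 n) 𝓘(ℝ, EuclideanSpace ℝ (Fin n) →L[ℝ] EuclideanSpace ℝ (Fin n)) 1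
      A y := contMDiffAt_const.clm_comp hD
  have hAy : A y = ((1 : (EuclideanSpace ℝ (Fin n) →L[ℝ] EuclideanSpace ℝ (Fin n))ˣ) :
      EuclideanSpace ℝ (Fin n) →L[ℝ] EuclideanSpace ℝ (Fin n)) := by
    ext1 u
    exact LinearMap.congr_fun hL u
  have hAinv : ContMDiffAt (𝓡 n) 𝓘(ℝ, EuclideanSpace ℝ (Fin n) →L[ℝ] EuclideanSpace ℝ (Fin n)) 1
      (fun x ↦ Ring.inverse (A x)) y := by
    have h1 := contDiffAt_ringInverse ℝ (n := 1)
      (1 : (EuclideanSpace ℝ (Fin n) →L[ℝ] EuclideanSpace ℝ (Fin n))ˣ)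
    rw [← hAy] at h1
    exact ContMDiffAt.comp y h1.contMDiffAt hA
  have hunit : ∀ᶠ x in 𝓝 y, IsUnit (A x) := by
    have := hA.continuousAt
    refine this.eventually (Units.isOpen.mem_nhds ?_)
    rw [hAy]
    exact Units.isUnit _
  refine (contMDiffAt_field_iff (f := fun x ↦ x)).2 ⟨contMDiffAt_id, ?_⟩
  have hfin : ContMDiffAt (𝓡 n) 𝓘(ℝ, EuclideanSpace ℝ (Fin n)) 1
      (fun x ↦ Ring.inverse (A x) (LinearMap.toContinuousLinearMap L (fieldCoord ι w (ι y) x))) y :=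
    hAinv.clm_apply ((LinearMap.toContinuousLinearMap L).contMDiff.contMDiffAt.comp y hwc)
  refine hfin.congr_of_eventuallyEq ?_
  filter_upwards [hev, hunit] with x hx hxu
  rw [← hx]
  have h2 : Ring.inverse (A x) * A x = 1 := Ring.inverse_mul_cancel _ hxu
  exact (congrArg (fun B ↦ B (sectionCoord v y x)) h2).symm

end Lift

/-! ### The ruling line field on the patch. -/

section Patch

variable {n : ℕ} {M : Type*} [TopologicalSpace M]
  [ChartedSpace (EuclideanSpace ℝ (Fin (n + 1))) M] [IsManifold (𝓡 (n + 1)) ∞ M]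
  {S : SubRiemannianStructure (n + 1) M} {V : VerticallyRigidStructure S}
  {P : Type*} [TopologicalSpace P]
  [ChartedSpace (EuclideanSpace ℝ (Fin n)) P] [IsManifold (𝓡 n) 2 P]
  {ι : P → M} {ν : (x : P) → TangentSpace (𝓡 (n + 1)) (ι x)}

/-- Near every point there is a `C¹` vector field on the patch whose image is the horizontal unit
field orthogonal to `ν`. -/
theorem exists_local_ruling_field (hrank : S.rank = 2)
    (hp : IsNoncharacteristicPatch (n := n) V ι ν) (x₀ : P) :
    ∃ v : (x : P) → TangentSpace (𝓡 n) x, ∃ O : Set P, IsOpen O ∧ x₀ ∈ O ∧ ∀ x ∈ O,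
      ContMDiffAt (𝓡 n) (𝓡 n).tangent 1 (fun x ↦ (⟨x, v x⟩ : TangentBundle (𝓡 n) P)) x ∧
      ContMDiffAt (𝓡 n) (𝓡 (n + 1)).tangent 1 (fun x ↦ (⟨ι x, mfderiv (𝓡 n) (𝓡 (n + 1)) ι x (v x)⟩ :
        TangentBundle (𝓡 (n + 1)) M)) x ∧
      mfderiv (𝓡 n) (𝓡 (n + 1)) ι x (v x) ∈ S.horizontal (ι x) ∧
      V.metric.inner (ι x) (mfderiv (𝓡 n) (𝓡 (n + 1)) ι x (v x))
        (mfderiv (𝓡 n) (𝓡 (n + 1)) ι x (v x)) = 1 ∧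
      V.metric.inner (ι x) (mfderiv (𝓡 n) (𝓡 (n + 1)) ι x (v x)) (ν x) = 0 := by
  obtain ⟨w, hw⟩ := exists_local_unit_field hrank hp x₀
  have hex : ∀ x, ∃ u : TangentSpace (𝓡 n) x, w x ∈ tangentImage (n := n) ι x →
      mfderiv (𝓡 n) (𝓡 (n + 1)) ι x u = w x := by
    intro x
    by_cases h : w x ∈ tangentImage (n := n) ι x
    · obtain ⟨u, hu⟩ := h
      exact ⟨u, fun _ ↦ hu⟩
    · exact ⟨0, fun h' ↦ absurd h' h⟩
  choose v hv using hex
  obtain ⟨O, hO, hOo, hxO⟩ := eventually_nhds_iff.1 hw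
  have hvw : ∀ x ∈ O, mfderiv (𝓡 n) (𝓡 (n + 1)) ι x (v x) = w x := fun x hx ↦ hv x
    (mem_tangentImage_of_metric_normal_eq_zero hrank hp (hO x hx).2.1 (hO x hx).2.2.2)
  refine ⟨v, O, hOo, hxO, fun x hx ↦ ?_⟩
  have hev : ∀ᶠ y in 𝓝 x, mfderiv (𝓡 n) (𝓡 (n + 1)) ι y (v y) = w y := by
    filter_upwards [hOo.mem_nhds hx] with y hy using hvw y hy
  obtain ⟨h1, h2, h3, h4⟩ := hO x hx
  refine ⟨contMDiffAt_lift hp.contMDiff (hp.immersive x) h1 hev, ?_, ?_⟩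
  · refine h1.congr_of_eventuallyEq ?_
    filter_upwards [hev] with y hy
    rw [hy]
  · rw [hvw x hx]
    exact ⟨h2, h3, h4⟩

end Patch

/-! ### Leaves from curves that are locally unique up to reversal. -/

section AbstractFoliation

variable {P : Type*} [TopologicalSpace P]

/-- A pointwise condition `R c t` on curves `c` at times `t` which, like the condition of being
tangent to a line field, is local, invariant under the isometries of the line, and determines
curves locally up to reversal. -/
structure IsCurveLaw (R : (ℝ → P) → ℝ → Prop) : Prop where
  congr : ∀ {c c' : ℝ → P} {t : ℝ}, c =ᶠ[𝓝 t] c' → R c t → R c' t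
  translate : ∀ {c : ℝ → P} {t b : ℝ}, R c (b + t) → R (fun s ↦ c (b + s)) t
  reflect : ∀ {c : ℝ → P} {t : ℝ}, R c (-t) → R (fun s ↦ c (-s)) t
  continuousAt : ∀ {c : ℝ → P} {t : ℝ}, R c t → ContinuousAt c t
  eq_or_eq_neg : ∀ {c c' : ℝ → P}, (∀ᶠ s in 𝓝 0, R c s) → (∀ᶠ s in 𝓝 0, R c' s) → c 0 = c' 0 →
    (∀ᶠ s in 𝓝 0, c s = c' s) ∨ ∀ᶠ s in 𝓝 0, c s = c' (-s)
  eventually_ne : ∀ {c : ℝ → P}, (∀ᶠ s in 𝓝 0, R c s) → ∀ᶠ s in 𝓝 (0 : ℝ), c s = c (-s) → s = 0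

/-- `c` satisfies the law `R` on the nonempty open interval `J`. -/
structure IsLawfulCurve (R : (ℝ → P) → ℝ → Prop) (c : ℝ → P) (J : Set ℝ) : Prop where
  isOpen : IsOpen J
  ordConnected : J.OrdConnected
  nonempty : J.Nonempty
  law : ∀ t ∈ J, R c t

variable {R : (ℝ → P) → ℝ → Prop}

theorem eventually_nhds_iff_const_add {p : ℝ → Prop} (t : ℝ) :
    (∀ᶠ s in 𝓝 0, p (t + s)) ↔ ∀ᶠ s in 𝓝 t, p s := by
  rw [← map_add_left_nhds_zero t, Filter.eventually_map]

namespace IsLawfulCurve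

variable {c c' : ℝ → P} {J J' : Set ℝ}

omit [TopologicalSpace P] in
theorem eventually (h : IsLawfulCurve R c J) {t : ℝ} (ht : t ∈ J) : ∀ᶠ s in 𝓝 t, R c s := by
  filter_upwards [h.isOpen.mem_nhds ht] with s hs using h.law s hs

omit [TopologicalSpace P] in
theorem mono (h : IsLawfulCurve R c J) (ho : IsOpen J') (hc : J'.OrdConnected)
    (hn : J'.Nonempty) (hs : J' ⊆ J) : IsLawfulCurve R c J' :=
  ⟨ho, hc, hn, fun t ht ↦ h.law t (hs ht)⟩

theorem translate (hR : IsCurveLaw R) (h : IsLawfulCurve R c J) (b : ℝ) :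
    IsLawfulCurve R (fun s ↦ c (b + s)) ((fun s ↦ b + s) ⁻¹' J) where
  isOpen := h.isOpen.preimage (by fun_prop)
  ordConnected := ⟨fun x hx y hy z hz ↦ h.ordConnected.out hx hy
    ⟨add_le_add_right hz.1 b, add_le_add_right hz.2 b⟩⟩
  nonempty := by
    obtain ⟨t, ht⟩ := h.nonempty
    exact ⟨t - b, by simpa using ht⟩
  law t ht := hR.translate (h.law _ ht)

theorem reflect (hR : IsCurveLaw R) (h : IsLawfulCurve R c J) :
    IsLawfulCurve R (fun s ↦ c (-s)) ((fun s ↦ -s) ⁻¹' J) where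
  isOpen := h.isOpen.preimage (by fun_prop)
  ordConnected := ⟨fun x hx y hy z hz ↦ h.ordConnected.out hy hx
    ⟨neg_le_neg hz.2, neg_le_neg hz.1⟩⟩
  nonempty := by
    obtain ⟨t, ht⟩ := h.nonempty
    exact ⟨-t, by simpa using ht⟩
  law t ht := hR.reflect (h.law _ ht)

/-- Unique continuation. -/
theorem eqOn [T2Space P] (hR : IsCurveLaw R) (h : IsLawfulCurve R c J) (h' : IsLawfulCurve R c' J)
    {t₀ : ℝ} (ht₀ : t₀ ∈ J) (heq : c =ᶠ[𝓝 t₀] c') : EqOn c c' J := by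
  have hopen : IsOpen {t | c =ᶠ[𝓝 t] c'} := isOpen_setOfPred_eventually_nhds
  have hsub : J ⊆ {t | c =ᶠ[𝓝 t] c'} := by
    -- The times at which the germs agree form an open set; J is connected, so it remains to see
    -- that this set is relatively closed in J.
    refine h.ordConnected.isPreconnected.subset_of_closure_inter_subset hopen ⟨t₀, ht₀, heq⟩ ?_
    rintro t ⟨htc, htJ⟩
    have hfreq : ∃ᶠ s in 𝓝 t, c s = c' s := by
      refine (mem_closure_iff_frequently.1 htc).mono fun s hs ↦ ?_
      exact Filter.Eventually.self_of_nhds (p := fun s ↦ c s = c' s) hs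
    have hct : c t = c' t := tendsto_nhds_unique_of_frequently_eq
      (hR.continuousAt (h.law t htJ)) (hR.continuousAt (h'.law t htJ)) hfreq
    have hR1 : ∀ᶠ s in 𝓝 0, R (fun s ↦ c (t + s)) s := by
      refine ((eventually_nhds_iff_const_add t).2 (h.eventually htJ)).mono fun s hs ↦ ?_
      exact hR.translate hs
    have hR2 : ∀ᶠ s in 𝓝 0, R (fun s ↦ c' (t + s)) s := by
      refine ((eventually_nhds_iff_const_add t).2 (h'.eventually htJ)).mono fun s hs ↦ ?_
      exact hR.translate hs
    rcases hR.eq_or_eq_neg hR1 hR2 (by simpa using hct) with hE | hE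
    · exact (eventually_nhds_iff_const_add t).1 hE
    -- In the reversed case, a nearby time t + s of agreement gives c (t + s) = c (t - s). Since c
    -- does not fold back at t, this forces s = 0, so the germs agree at t itself.
    · have hE' : ∀ᶠ s in 𝓝 (0 : ℝ), c (t + -s) = c' (t + s) := by
        have : Filter.Tendsto (fun s : ℝ ↦ -s) (𝓝 0) (𝓝 0) := by
          simpa using (continuous_neg (G := ℝ)).tendsto 0
        filter_upwards [this.eventually hE] with s hs
        simpa using hs
      have hfreq0 : ∃ᶠ s in 𝓝 (0 : ℝ), t + s ∈ {t | c =ᶠ[𝓝 t] c'} := by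
        have := mem_closure_iff_frequently.1 htc
        rwa [← map_add_left_nhds_zero t, Filter.frequently_map] at this
      obtain ⟨s, ⟨hs1, hs2⟩, hs3⟩ :=
        ((hfreq0.and_eventually hE').and_eventually (hR.eventually_ne hR1)).exists
      have hs4 : c (t + s) = c' (t + s) :=
        Filter.Eventually.self_of_nhds (p := fun s ↦ c s = c' s) hs1
      have hs0 : s = 0 := hs3 (hs4.trans hs2.symm)
      rw [hs0, add_zero] at hs1
      exact hs1
  intro t ht
  exact Filter.Eventually.self_of_nhds (p := fun s ↦ c s = c' s) (hsub ht)

end IsLawfulCurve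

/-- Lawful curves with the same germ at `0` have a common extension. -/
theorem exists_maximal_lawful_curve [T2Space P] (hR : IsCurveLaw R) {c₀ : ℝ → P} {J₀ : Set ℝ}
    (h₀ : IsLawfulCurve R c₀ J₀) (h0 : (0 : ℝ) ∈ J₀) :
    ∃ c J, IsLawfulCurve R c J ∧ ∀ c' J', IsLawfulCurve R c' J' → 0 ∈ J' → c' =ᶠ[𝓝 0] c₀ →
      c' '' J' ⊆ c '' J := by
  classical
  let F : Set ((ℝ → P) × Set ℝ) := {q | IsLawfulCurve R q.1 q.2 ∧ 0 ∈ q.2 ∧ q.1 =ᶠ[𝓝 0] c₀}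
  let c : ℝ → P := fun t ↦ if h : ∃ q ∈ F, t ∈ q.2 then h.choose.1 t else c₀ t
  -- The choice made in `c` is harmless: two members of F overlap in an interval containing 0, where
  -- unique continuation identifies them.
  have hc : ∀ q ∈ F, EqOn c q.1 q.2 := by
    intro q hq t ht
    have hex : ∃ q ∈ F, t ∈ q.2 := ⟨q, hq, ht⟩
    have h1 := hex.choose_spec
    have h2 : c t = hex.choose.1 t := dif_pos hex
    rw [h2]
    obtain ⟨⟨ha, hb, hd⟩, he⟩ := h1
    obtain ⟨ha', hb', hd'⟩ := hq
    have ho := ha.isOpen.inter ha'.isOpen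
    have hoc := ha.ordConnected.inter ha'.ordConnected
    have hn : (hex.choose.2 ∩ q.2).Nonempty := ⟨0, hb, hb'⟩
    exact (ha.mono ho hoc hn inter_subset_left).eqOn hR (ha'.mono ho hoc hn inter_subset_right)
      ⟨hb, hb'⟩ (hd.trans hd'.symm) ⟨he, ht⟩
  refine ⟨c, ⋃ q ∈ F, q.2, ⟨?_, ?_, ?_, ?_⟩, ?_⟩
  · exact isOpen_biUnion fun q hq ↦ hq.1.isOpen
  · refine IsPreconnected.ordConnected ?_
    rw [← sUnion_image]
    refine isPreconnected_sUnion 0 _ ?_ ?_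
    · rintro _ ⟨q, hq, rfl⟩
      exact hq.2.1
    · rintro _ ⟨q, hq, rfl⟩
      exact hq.1.ordConnected.isPreconnected
  · exact ⟨0, mem_biUnion (show (c₀, J₀) ∈ F from ⟨h₀, h0, Filter.EventuallyEq.rfl⟩) h0⟩
  · intro t ht
    obtain ⟨q, hq, htq⟩ := mem_iUnion₂.1 ht
    refine hR.congr ?_ (hq.1.law t htq)
    filter_upwards [hq.1.isOpen.mem_nhds htq] with s hs using (hc q hq hs).symm
  · rintro c' J' h' h0' heq _ ⟨t, ht, rfl⟩
    have hq : (c', J') ∈ F := ⟨h', h0', heq⟩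
    exact ⟨t, mem_biUnion hq ht, hc _ hq ht⟩

/-- Shift any curve through the given point so that it passes there at time 0. Its germ, or that of
its reversal, is then the germ of the given curve, so its image lies in that of the maximal
extension. -/
theorem exists_leaf [T2Space P] (hR : IsCurveLaw R) {c₀ : ℝ → P} {J₀ : Set ℝ}
    (h₀ : IsLawfulCurve R c₀ J₀) {t₀ : ℝ} (ht₀ : t₀ ∈ J₀) :
    ∃ A : Set P, (∃ c J, IsLawfulCurve R c J ∧ c '' J = A) ∧
      ∀ c J, IsLawfulCurve R c J → c₀ t₀ ∈ c '' J → c '' J ⊆ A := by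
  have h₁ := h₀.translate hR t₀
  have h10 : (0 : ℝ) ∈ (fun s ↦ t₀ + s) ⁻¹' J₀ := by simpa using ht₀
  obtain ⟨c, J, hc, hmax⟩ := exists_maximal_lawful_curve hR h₁ h10
  refine ⟨c '' J, ⟨c, J, hc, rfl⟩, ?_⟩
  rintro c' J' h' ⟨t, ht, htx⟩
  have h'' := h'.translate hR t
  have h0 : (0 : ℝ) ∈ (fun s ↦ t + s) ⁻¹' J' := by simpa using ht
  have himg : (fun s ↦ c' (t + s)) '' ((fun s ↦ t + s) ⁻¹' J') = c' '' J' := by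
    ext y
    constructor
    · rintro ⟨s, hs, rfl⟩
      exact ⟨t + s, hs, rfl⟩
    · rintro ⟨s, hs, rfl⟩
      exact ⟨s - t, by simpa using hs, by simp⟩
  rcases hR.eq_or_eq_neg (h''.eventually h0) (h₁.eventually h10) (by simpa using htx) with hE | hE
  · rw [← himg]
    exact hmax _ _ h'' h0 hE
  · have h3 := h''.reflect hR
    have himg' : (fun s ↦ c' (t + -s)) '' ((fun s ↦ -s) ⁻¹' ((fun s ↦ t + s) ⁻¹' J')) =
        c' '' J' := by
      rw [← himg]
      ext y
      constructor
      · rintro ⟨s, hs, rfl⟩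
        exact ⟨-s, hs, rfl⟩
      · rintro ⟨s, hs, rfl⟩
        exact ⟨-s, by simpa using hs, by simp⟩
    rw [← himg']
    refine hmax _ _ h3 (by simpa using ht) ?_
    have : Filter.Tendsto (fun s : ℝ ↦ -s) (𝓝 0) (𝓝 0) := by
      simpa using (continuous_neg (G := ℝ)).tendsto 0
    filter_upwards [this.eventually hE] with s hs
    simpa using hs

/-- If `P` is covered by product charts whose plaques are lawful curves, then the maximal lawful
curves foliate `P`. -/
theorem exists_isFoliationByCurves [T2Space P] (n : ℕ) (hR : IsCurveLaw R)
    (hchart : ∀ x : P, ∃ (φ : OpenPartialHomeomorph P (ℝ × EuclideanSpace ℝ (Fin (n - 1))))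
      (ε : ℝ) (U : Set (EuclideanSpace ℝ (Fin (n - 1)))),
      x ∈ φ.source ∧ 0 < ε ∧ φ.target = Ioo (-ε) ε ×ˢ U ∧
      ∀ y ∈ U, IsLawfulCurve R (fun t ↦ φ.symm (t, y)) (Ioo (-ε) ε)) :
    ∃ L : Set (Set P), IsFoliationByCurves n (IsLawfulCurve R) L := by
  have hthrough : ∀ x : P, ∃ c J t, IsLawfulCurve R c J ∧ t ∈ J ∧ c t = x := by
    intro x
    obtain ⟨φ, ε, U, hx, hε, htar, hcur⟩ := hchart x
    have h1 : φ x ∈ Ioo (-ε) ε ×ˢ U := htar ▸ φ.map_source hx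
    exact ⟨_, _, (φ x).1, hcur (φ x).2 h1.2, h1.1, φ.left_inv hx⟩
  have hleaf : ∀ x : P, ∃ A : Set P, (∃ c J, IsLawfulCurve R c J ∧ c '' J = A) ∧
      ∀ c J, IsLawfulCurve R c J → x ∈ c '' J → c '' J ⊆ A := by
    intro x
    obtain ⟨c, J, t, h, ht, rfl⟩ := hthrough x
    exact exists_leaf hR h ht
  choose leaf hcurve hmax using hleaf
  have hmem : ∀ x, x ∈ leaf x := by
    intro x
    obtain ⟨c, J, t, h, ht, rfl⟩ := hthrough x
    exact hmax _ c J h ⟨t, ht, rfl⟩ ⟨t, ht, rfl⟩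
  -- A leaf is itself the image of one lawful curve, so it is absorbed by the leaf of each of its
  -- points. Applied in both directions, this gives equality.
  have hsub : ∀ x y, y ∈ leaf x → leaf x ⊆ leaf y := by
    intro x y hy
    obtain ⟨c, J, h, hA⟩ := hcurve x
    rw [← hA] at hy ⊢
    exact hmax y c J h hy
  have heq : ∀ x y, y ∈ leaf x → leaf x = leaf y := fun x y hy ↦
    (hsub x y hy).antisymm (hsub y x (hsub x y hy (hmem x)))
  have hpart : Setoid.IsPartition (range leaf) := by
    refine ⟨?_, fun x ↦ ⟨leaf x, ⟨⟨x, rfl⟩, hmem x⟩, ?_⟩⟩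
    · rintro ⟨x, hx⟩
      have := hmem x
      rw [hx] at this
      exact this
    · rintro _ ⟨⟨y, rfl⟩, hy⟩
      exact heq y x hy
  have himage : ∀ (c : ℝ → P) (J : Set ℝ), IsLawfulCurve R c J →
      ∃ A ∈ range leaf, c '' J ⊆ A := by
    intro c J h
    obtain ⟨t, ht⟩ := h.nonempty
    exact ⟨_, ⟨c t, rfl⟩, hmax (c t) c J h ⟨t, ht, rfl⟩⟩
  refine ⟨range leaf, hpart, ?_, himage, ?_⟩
  · rintro _ ⟨x, rfl⟩
    exact hcurve x
  · intro x
    obtain ⟨φ, ε, U, hx, hε, htar, hcur⟩ := hchart x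
    refine ⟨φ, ε, U, hx, hε, htar, hcur, ?_⟩
    rintro _ ⟨z, rfl⟩ a ha b hb hab haz
    have h1 : φ a ∈ Ioo (-ε) ε ×ˢ U := htar ▸ φ.map_source ha
    have h2 : φ b ∈ Ioo (-ε) ε ×ˢ U := htar ▸ φ.map_source hb
    obtain ⟨A, ⟨w, rfl⟩, hA⟩ := himage _ _ (hcur (φ a).2 h1.2)
    have haw : a ∈ leaf w := hA ⟨(φ a).1, h1.1, φ.left_inv ha⟩
    have hbw : b ∈ leaf w := hA ⟨(φ b).1, h2.1, by
      change φ.symm ((φ b).1, (φ a).2) = b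
      rw [hab]
      exact φ.left_inv hb⟩
    rw [heq z a haz, ← heq w a haw]
    exact hbw

end AbstractFoliation

/-! ### Flow boxes of C¹ vector fields in Euclidean space. -/

section FlowBox

variable {E : Type*} [NormedAddCommGroup E] [NormedSpace ℝ E] [CompleteSpace E]

/-- The local flow of a `C¹` vector field is strictly differentiable at the base point. -/
theorem exists_local_flow_hasStrictFDerivAt {F : E → E} {z₀ : E} (hF : ContDiffAt ℝ 1 F z₀) :
    ∃ (Φ : E → ℝ → E) (δ : ℝ), 0 < δ ∧ Φ z₀ 0 = z₀ ∧
      (∀ z ∈ Metric.ball z₀ δ, ∀ t ∈ Ioo (-δ) δ, HasDerivAt (Φ z) (F (Φ z t)) t) ∧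
      HasStrictFDerivAt (fun q : ℝ × E ↦ Φ q.2 q.1)
        ((ContinuousLinearMap.fst ℝ ℝ E).smulRight (F z₀) + ContinuousLinearMap.snd ℝ ℝ E)
        (0, z₀) := by
  obtain ⟨K, N, hN, hK⟩ := hF.exists_lipschitzOnWith
  obtain ⟨ε, hε, a, r, L, K', hr, hpl⟩ := IsPicardLindelof.of_contDiffAt_one hF
  obtain ⟨Φ, hΦ, L', hL'⟩ :=
    (hpl 0).exists_forall_mem_closedBall_eq_hasDerivWithinAt_lipschitzOnWith
  have hr' : (0 : ℝ) < r := hr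
  simp only [zero_sub, zero_add] at hΦ hL'
  set δ := min ε r with hδ
  have hδ0 : 0 < δ := lt_min hε hr'
  have hball : Metric.ball z₀ δ ⊆ Metric.closedBall z₀ r :=
    Metric.ball_subset_closedBall.trans (Metric.closedBall_subset_closedBall (min_le_right _ _))
  have hIoo : ∀ t ∈ Ioo (-δ) δ, t ∈ Ioo (-ε) ε := fun t ht ↦
    ⟨by linarith [ht.1, min_le_left ε (r : ℝ)], ht.2.trans_le (min_le_left _ _)⟩
  have hz₀ : z₀ ∈ Metric.closedBall z₀ (r : ℝ) := Metric.mem_closedBall_self hr'.le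
  have hderiv : ∀ z ∈ Metric.ball z₀ δ, ∀ t ∈ Ioo (-δ) δ, HasDerivAt (Φ z) (F (Φ z t)) t := by
    intro z hz t ht
    exact ((hΦ z (hball hz)).2 t (Ioo_subset_Icc_self (hIoo t ht))).hasDerivAt
      (Icc_mem_nhds (hIoo t ht).1 (hIoo t ht).2)
  refine ⟨Φ, δ, hδ0, (hΦ z₀ hz₀).1, hderiv, .of_isLittleO ?_⟩
  have hcont : ContinuousAt (fun q : ℝ × E ↦ Φ q.2 q.1) (0, z₀) := by
    have h1 : ContinuousOn (Function.uncurry Φ) (Metric.closedBall z₀ r ×ˢ Icc (-ε) ε) := by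
      refine continuousOn_prod_of_continuousOn_lipschitzOnWith _ L' (fun z hz ↦ ?_) hL'
      exact fun t ht ↦ ((hΦ z hz).2 t ht).continuousWithinAt
    have h2 : ContinuousAt (Function.uncurry Φ) (z₀, 0) := h1.continuousAt
      (prod_mem_nhds (Metric.closedBall_mem_nhds _ hr') (Icc_mem_nhds (by linarith) hε))
    exact ContinuousAt.comp (x := ((0 : ℝ), z₀)) (f := fun q : ℝ × E ↦ (q.2, q.1)) h2 (by fun_prop)
  rw [Asymptotics.isLittleO_iff]
  intro c hc
  have hFc : ∀ᶠ z in 𝓝 z₀, z ∈ N ∧ ‖F z - F z₀‖ ≤ c / 2 := by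
    refine Filter.Eventually.and hN ?_
    have := hF.continuousAt.eventually (Metric.closedBall_mem_nhds (F z₀) (half_pos hc))
    simpa [dist_eq_norm] using this
  have hev : ∀ᶠ q : ℝ × E in 𝓝 (0, z₀), Φ q.2 q.1 ∈ N ∧ ‖F (Φ q.2 q.1) - F z₀‖ ≤ c / 2 := by
    refine hcont.eventually (p := fun z ↦ z ∈ N ∧ ‖F z - F z₀‖ ≤ c / 2) ?_
    simpa only [(hΦ z₀ hz₀).1] using hFc
  obtain ⟨ρ, hρ, hρN⟩ := Metric.eventually_nhds_iff_ball.1 hev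
  set κ : ℝ := K * L' with hκ
  have hκ0 : 0 ≤ κ := by positivity
  -- The last bound makes κη ≤ c / 2; the + 1 allows κ = 0.
  set η := min (min ρ δ) (c / (2 * (κ + 1))) with hη
  have hη0 : 0 < η := lt_min (lt_min hρ hδ0) (by positivity)
  have hηρ : η ≤ ρ := (min_le_left _ _).trans (min_le_left _ _)
  have hηδ : η ≤ δ := (min_le_left _ _).trans (min_le_right _ _)
  have hηκ : κ * η ≤ c / 2 := by
    calc κ * η ≤ κ * (c / (2 * (κ + 1))) := by gcongr; exact min_le_right _ _
      _ = (κ / (κ + 1)) * (c / 2) := by field_simp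
      _ ≤ 1 * (c / 2) := by
        gcongr
        rw [div_le_one (by positivity)]
        linarith
      _ = c / 2 := one_mul _
  have hnear : ∀ z ∈ Metric.ball z₀ η, ∀ t ∈ Ioo (-η) η,
      Φ z t ∈ N ∧ ‖F (Φ z t) - F z₀‖ ≤ c / 2 := by
    intro z hz t ht
    refine hρN (t, z) ?_
    rw [← ball_prod_same]
    refine ⟨?_, Metric.ball_subset_ball hηρ hz⟩
    rw [Real.ball_eq_Ioo]
    exact ⟨by linarith [ht.1], by linarith [ht.2]⟩
  have hsub : ∀ t ∈ Ioo (-η) η, t ∈ Ioo (-δ) δ := fun t ht ↦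
    ⟨by linarith [ht.1], ht.2.trans_le hηδ⟩
  -- Mean value inequality in time: the derivative of Φ z s - s • F z₀ is at most c / 2 in norm.
  have htime : ∀ z ∈ Metric.ball z₀ η, ∀ t ∈ Ioo (-η) η, ∀ t' ∈ Ioo (-η) η,
      ‖Φ z t - Φ z t' - (t - t') • F z₀‖ ≤ c / 2 * |t - t'| := by
    intro z hz t ht t' ht'
    have h1 : ∀ s ∈ Ioo (-η) η, HasDerivWithinAt (fun s ↦ Φ z s - s • F z₀)
        (F (Φ z s) - (1 : ℝ) • F z₀) (Ioo (-η) η) s := fun s hs ↦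
      ((hderiv z (Metric.ball_subset_ball hηδ hz) s (hsub s hs)).sub
        ((hasDerivAt_id s).smul_const (F z₀))).hasDerivWithinAt
    have h2 := (convex_Ioo (-η) η).norm_image_sub_le_of_norm_hasDerivWithin_le
      (C := c / 2) h1 (fun s hs ↦ by simpa using (hnear z hz s hs).2) ht' ht
    rw [Real.norm_eq_abs] at h2
    refine le_trans (le_of_eq ?_) h2
    congr 1
    rw [sub_smul]
    abel
  -- Two trajectories separate at speed at most κ ‖z - z'‖, by the Lipschitz bounds for F and for
  -- the flow. Over time η this contributes at most c / 2 · ‖z - z'‖.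
  have hspace : ∀ z ∈ Metric.ball z₀ η, ∀ z' ∈ Metric.ball z₀ η, ∀ t ∈ Ioo (-η) η,
      ‖Φ z t - Φ z' t - (z - z')‖ ≤ c / 2 * ‖z - z'‖ := by
    intro z hz z' hz' t ht
    have hzr := hball (Metric.ball_subset_ball hηδ hz)
    have hzr' := hball (Metric.ball_subset_ball hηδ hz')
    have h0 : (0 : ℝ) ∈ Ioo (-η) η := ⟨by linarith, hη0⟩
    have h1 : ∀ s ∈ Ioo (-η) η, HasDerivWithinAt (fun s ↦ Φ z s - Φ z' s)
        (F (Φ z s) - F (Φ z' s)) (Ioo (-η) η) s := fun s hs ↦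
      ((hderiv z (Metric.ball_subset_ball hηδ hz) s (hsub s hs)).sub
        (hderiv z' (Metric.ball_subset_ball hηδ hz') s (hsub s hs))).hasDerivWithinAt
    have hbd : ∀ s ∈ Ioo (-η) η, ‖F (Φ z s) - F (Φ z' s)‖ ≤ κ * ‖z - z'‖ := by
      intro s hs
      have h3 := hK.dist_le_mul _ (hnear z hz s hs).1 _ (hnear z' hz' s hs).1
      have h4 := (hL' s (Ioo_subset_Icc_self (hIoo s (hsub s hs)))).dist_le_mul _ hzr _ hzr'
      rw [dist_eq_norm, dist_eq_norm] at h3 h4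
      calc _ ≤ K * ‖Φ z s - Φ z' s‖ := h3
        _ ≤ K * (L' * ‖z - z'‖) := by gcongr
        _ = κ * ‖z - z'‖ := by rw [hκ, mul_assoc]
    have h2 := (convex_Ioo (-η) η).norm_image_sub_le_of_norm_hasDerivWithin_le h1 hbd h0 ht
    simp only [(hΦ z hzr).1, (hΦ z' hzr').1, sub_zero, Real.norm_eq_abs] at h2
    refine h2.trans ?_
    have : |t| ≤ η := abs_le.2 ⟨ht.1.le, ht.2.le⟩
    calc κ * ‖z - z'‖ * |t| ≤ κ * ‖z - z'‖ * η := by gcongr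
      _ = (κ * η) * ‖z - z'‖ := by ring
      _ ≤ c / 2 * ‖z - z'‖ := by gcongr
  have hnhds : ∀ᶠ q : ℝ × E in 𝓝 (0, z₀), q.1 ∈ Ioo (-η) η ∧ q.2 ∈ Metric.ball z₀ η :=
    prod_mem_nhds (Ioo_mem_nhds (by linarith) hη0) (Metric.ball_mem_nhds _ hη0)
  rw [nhds_prod_eq]
  filter_upwards [hnhds.prod_mk hnhds] with ⟨⟨t, z⟩, ⟨t', z'⟩⟩ ⟨⟨h1, h2⟩, ⟨h3, h4⟩⟩
  simp only at h1 h2 h3 h4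
  have e : Φ z t - Φ z' t' - (((ContinuousLinearMap.fst ℝ ℝ E).smulRight (F z₀) +
      ContinuousLinearMap.snd ℝ ℝ E) ((t, z) - (t', z'))) =
      (Φ z t - Φ z t' - (t - t') • F z₀) + (Φ z t' - Φ z' t' - (z - z')) := by
    simp
    abel
  have hn1 : |t - t'| ≤ ‖((t, z) : ℝ × E) - (t', z')‖ := norm_fst_le (((t, z) : ℝ × E) - (t', z'))
  have hn2 : ‖z - z'‖ ≤ ‖((t, z) : ℝ × E) - (t', z')‖ := norm_snd_le (((t, z) : ℝ × E) - (t', z'))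
  simp only
  rw [e]
  calc _ ≤ c / 2 * |t - t'| + c / 2 * ‖z - z'‖ :=
        norm_add_le_of_le (htime z h2 t h1 t' h3) (hspace z h2 z' h4 t' h3)
    _ ≤ c / 2 * ‖((t, z) : ℝ × E) - (t', z')‖ + c / 2 * ‖((t, z) : ℝ × E) - (t', z')‖ := by gcongr
    _ = c * ‖((t, z) : ℝ × E) - (t', z')‖ := by ring

/-- A vector in an `n`-dimensional space extends to linear coordinates. -/
theorem exists_linear_complement {n : ℕ} {w : EuclideanSpace ℝ (Fin n)} (hw : w ≠ 0) :
    ∃ (A : EuclideanSpace ℝ (Fin (n - 1)) →L[ℝ] EuclideanSpace ℝ (Fin n))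
      (B : (ℝ × EuclideanSpace ℝ (Fin (n - 1))) ≃L[ℝ] EuclideanSpace ℝ (Fin n)),
      ∀ t y, B (t, y) = t • w + A y := by
  -- A nonzero w excludes n = 0, so the truncated n - 1 really is the codimension of a line.
  have hn : 0 < n := by
    rcases Nat.eq_zero_or_pos n with rfl | h
    · exact absurd (Subsingleton.elim w 0) hw
    · exact h
  have hfin : Module.finrank ℝ (EuclideanSpace ℝ (Fin n)) = (n - 1) + 1 := by
    rw [finrank_euclideanSpace, Fintype.card_fin]
    omega
  have : Fact (Module.finrank ℝ (EuclideanSpace ℝ (Fin n)) = (n - 1) + 1) := ⟨hfin⟩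
  have hfin' : Module.finrank ℝ ((ℝ ∙ w)ᗮ : Submodule ℝ (EuclideanSpace ℝ (Fin n))) = n - 1 :=
    Submodule.finrank_orthogonal_span_singleton hw
  let b := (stdOrthonormalBasis ℝ ((ℝ ∙ w)ᗮ : Submodule ℝ (EuclideanSpace ℝ (Fin n)))).reindex
    (finCongr hfin')
  let A : EuclideanSpace ℝ (Fin (n - 1)) →L[ℝ] EuclideanSpace ℝ (Fin n) :=
    ((ℝ ∙ w)ᗮ).subtypeL.comp (b.repr.symm.toContinuousLinearEquiv : _ →L[ℝ] _)
  have hA : ∀ y, A y = (b.repr.symm y : EuclideanSpace ℝ (Fin n)) := fun y ↦ rfl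
  let T : (ℝ × EuclideanSpace ℝ (Fin (n - 1))) →ₗ[ℝ] EuclideanSpace ℝ (Fin n) :=
    ((ContinuousLinearMap.fst ℝ ℝ _).smulRight w + A.comp (ContinuousLinearMap.snd ℝ ℝ _) :
      (ℝ × EuclideanSpace ℝ (Fin (n - 1))) →L[ℝ] EuclideanSpace ℝ (Fin n))
  have hT : ∀ t y, T (t, y) = t • w + A y := fun t y ↦ by simp [T]
  have hinj : Function.Injective T := by
    rw [← LinearMap.ker_eq_bot, LinearMap.ker_eq_bot']
    rintro ⟨t, y⟩ h
    rw [hT, hA] at h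
    have h1 : inner ℝ w (b.repr.symm y : EuclideanSpace ℝ (Fin n)) = 0 :=
      Submodule.mem_orthogonal_singleton_iff_inner_right.1 (b.repr.symm y).2
    have h2 : inner ℝ w (t • w + (b.repr.symm y : EuclideanSpace ℝ (Fin n))) = 0 := by
      rw [h, inner_zero_right]
    rw [inner_add_right, h1, add_zero, inner_smul_right, real_inner_self_eq_norm_sq] at h2
    have ht : t = 0 := by
      rcases mul_eq_zero.1 h2 with h3 | h3
      · exact h3
      · exact absurd (norm_eq_zero.1 (pow_eq_zero_iff two_ne_zero |>.1 h3)) hw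
    subst ht
    rw [zero_smul, zero_add, ZeroMemClass.coe_eq_zero] at h
    have hy : y = 0 := by simpa using h
    rw [hy]
    rfl
  have hdim : Module.finrank ℝ (ℝ × EuclideanSpace ℝ (Fin (n - 1))) =
      Module.finrank ℝ (EuclideanSpace ℝ (Fin n)) := by
    rw [hfin, Module.finrank_prod, finrank_euclideanSpace, Fintype.card_fin, Module.finrank_self,
      add_comm]
  exact ⟨A, (LinearEquiv.ofInjectiveOfFinrankEq T hinj hdim).toContinuousLinearEquiv, hT⟩

/-- A `C¹` vector field has a flow box near each point where it does not vanish. -/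
theorem exists_flow_box {n : ℕ} {F : EuclideanSpace ℝ (Fin n) → EuclideanSpace ℝ (Fin n)}
    {z₀ : EuclideanSpace ℝ (Fin n)} (hF : ContDiffAt ℝ 1 F z₀) (h0 : F z₀ ≠ 0)
    {W : Set (EuclideanSpace ℝ (Fin n))} (hW : W ∈ 𝓝 z₀) :
    ∃ (Ψ : OpenPartialHomeomorph (ℝ × EuclideanSpace ℝ (Fin (n - 1))) (EuclideanSpace ℝ (Fin n)))
      (ε : ℝ) (U : Set (EuclideanSpace ℝ (Fin (n - 1)))),
      0 < ε ∧ Ψ.source = Ioo (-ε) ε ×ˢ U ∧ z₀ ∈ Ψ.target ∧ Ψ.target ⊆ W ∧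
      ∀ y ∈ U, ∀ t ∈ Ioo (-ε) ε, HasDerivAt (fun s ↦ Ψ (s, y)) (F (Ψ (t, y))) t := by
  obtain ⟨Φ, δ, hδ, hΦ0, hΦ, hstrict⟩ := exists_local_flow_hasStrictFDerivAt hF
  obtain ⟨A, B, hB⟩ := exists_linear_complement h0
  -- The flow is started on the affine slice z₀ + range A transverse to F z₀. Its derivative at the
  -- origin is (t, y) ↦ t • F z₀ + A y, which is the isomorphism B; strict differentiability at this
  -- one point suffices for the inverse function theorem.
  let j : ℝ × EuclideanSpace ℝ (Fin (n - 1)) → ℝ × EuclideanSpace ℝ (Fin n) :=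
    fun q ↦ (q.1, z₀ + A q.2)
  have hj0 : j (0, 0) = (0, z₀) := by simp [j]
  have hj : HasStrictFDerivAt j ((ContinuousLinearMap.fst ℝ ℝ _).prod
      (A.comp (ContinuousLinearMap.snd ℝ ℝ _))) (0, 0) :=
    hasStrictFDerivAt_fst.prodMk
      ((A.comp (ContinuousLinearMap.snd ℝ ℝ _)).hasStrictFDerivAt.const_add z₀)
  let f : ℝ × EuclideanSpace ℝ (Fin (n - 1)) → EuclideanSpace ℝ (Fin n) :=
    fun q ↦ Φ (z₀ + A q.2) q.1
  have hf : HasStrictFDerivAt f (B : (ℝ × EuclideanSpace ℝ (Fin (n - 1))) →L[ℝ] _) (0, 0) := by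
    rw [← hj0] at hstrict
    refine (hstrict.comp (0, 0) hj).congr_fderiv ?_
    ext q
    all_goals simp [hB]
  have hf0 : f (0, 0) = z₀ := by simp [f, hΦ0]
  let Ψ := hf.toOpenPartialHomeomorph f
  have hsrc : ∀ᶠ q in 𝓝 ((0 : ℝ), (0 : EuclideanSpace ℝ (Fin (n - 1)))),
      q ∈ Ψ.source ∧ f q ∈ W ∧ z₀ + A q.2 ∈ Metric.ball z₀ δ := by
    refine Filter.Eventually.and (Ψ.open_source.mem_nhds hf.mem_toOpenPartialHomeomorph_source)
      (Filter.Eventually.and (hf.continuousAt (by rwa [hf0])) ?_)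
    have : ContinuousAt (fun q : ℝ × EuclideanSpace ℝ (Fin (n - 1)) ↦ z₀ + A q.2) (0, 0) := by
      fun_prop
    exact this (by simpa using Metric.ball_mem_nhds z₀ hδ)
  obtain ⟨ρ, hρ, hρs⟩ := Metric.eventually_nhds_iff_ball.1 hsrc
  set ε := min ρ δ with hε
  have hε0 : 0 < ε := lt_min hρ hδ
  have hbox : ∀ q ∈ Ioo (-ε) ε ×ˢ Metric.ball (0 : EuclideanSpace ℝ (Fin (n - 1))) ρ,
      q ∈ Ψ.source ∧ f q ∈ W ∧ z₀ + A q.2 ∈ Metric.ball z₀ δ := by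
    rintro ⟨t, y⟩ ⟨ht, hy⟩
    refine hρs _ ?_
    rw [← ball_prod_same, Real.ball_eq_Ioo]
    exact ⟨⟨by linarith [ht.1, min_le_left ρ δ], by linarith [ht.2, min_le_left ρ δ]⟩, hy⟩
  have hopen : IsOpen (Ioo (-ε) ε ×ˢ Metric.ball (0 : EuclideanSpace ℝ (Fin (n - 1))) ρ) :=
    isOpen_Ioo.prod Metric.isOpen_ball
  let Ψ' := Ψ.restrOpen _ hopen
  have hsource : Ψ'.source = Ioo (-ε) ε ×ˢ Metric.ball (0 : EuclideanSpace ℝ (Fin (n - 1))) ρ := by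
    rw [OpenPartialHomeomorph.restrOpen_source]
    exact inter_eq_right.2 fun q hq ↦ (hbox q hq).1
  have hcoe : ∀ q, Ψ' q = f q := fun q ↦ rfl
  refine ⟨Ψ', ε, Metric.ball 0 ρ, hε0, hsource, ?_, ?_, ?_⟩
  · rw [← hf0, ← hcoe]
    refine Ψ'.map_source ?_
    rw [hsource]
    exact ⟨⟨by simpa using hε0, hε0⟩, Metric.mem_ball_self hρ⟩
  · intro z hz
    have h1 := Ψ'.map_target hz
    rw [hsource] at h1
    have h2 := (hbox _ h1).2.1
    rwa [← hcoe, Ψ'.right_inv hz] at h2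
  · intro y hy t ht
    exact hΦ _ (hbox (t, y) ⟨ht, hy⟩).2.2 t
      ⟨by linarith [ht.1, min_le_right ρ δ], by linarith [ht.2, min_le_right ρ δ]⟩

end FlowBox

/-! ### Velocities of curves and bootstrapping of regularity. -/

section Velocity

variable {d : ℕ} {M : Type*} [TopologicalSpace M] [ChartedSpace (EuclideanSpace ℝ (Fin d)) M]

/-- A curve in a vector space whose derivative is `C^k` is `C^(k+1)`. -/
theorem contDiffAt_succ_of_hasDerivAt {E : Type*} [NormedAddCommGroup E] [NormedSpace ℝ E]
    {f f' : ℝ → E} {t : ℝ} {k : ℕ} (h : ∀ᶠ s in 𝓝 t, HasDerivAt f (f' s) s)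
    (hf' : ContDiffAt ℝ k f' t) : ContDiffAt ℝ (k + 1) f t := by
  rw [contDiffAt_succ_iff_hasFDerivAt]
  refine ⟨fun s ↦ ContinuousLinearMap.toSpanSingleton ℝ (f' s), ⟨_, h, fun s hs ↦ hs.hasFDerivAt⟩,
    ?_⟩
  exact (ContinuousLinearMap.toSpanSingletonCLE (𝕜 := ℝ) (E := E)).contDiff.contDiffAt.comp t hf'

theorem velocity_const_add {γ : ℝ → M} {b t : ℝ}
    (hγ : MDifferentiableAt 𝓘(ℝ, ℝ) (𝓡 d) γ (b + t)) :
    velocity (d := d) (fun s ↦ γ (b + s)) t = velocity (d := d) γ (b + t) := by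
  have h1 : HasDerivAt (fun s : ℝ ↦ b + s) 1 t := (hasDerivAt_id t).const_add b
  have h2 := HasMFDerivAt.comp (f := fun s : ℝ ↦ b + s) t hγ.hasMFDerivAt
    h1.hasFDerivAt.hasMFDerivAt
  refine (congrArg (fun A ↦ A (1 : ℝ)) h2.mfderiv).trans ?_
  exact congrArg (mfderiv 𝓘(ℝ, ℝ) (𝓡 d) γ (b + t)) (one_smul ℝ (1 : ℝ))

theorem velocity_neg {γ : ℝ → M} {t : ℝ} (hγ : MDifferentiableAt 𝓘(ℝ, ℝ) (𝓡 d) γ (-t)) :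
    velocity (d := d) (fun s ↦ γ (-s)) t = -velocity (d := d) γ (-t) := by
  have h1 : HasDerivAt (fun s : ℝ ↦ -s) (-1) t := hasDerivAt_neg t
  have h2 := HasMFDerivAt.comp (f := fun s : ℝ ↦ -s) t hγ.hasMFDerivAt
    h1.hasFDerivAt.hasMFDerivAt
  refine (congrArg (fun A ↦ A (1 : ℝ)) h2.mfderiv).trans ?_
  refine (congrArg (mfderiv 𝓘(ℝ, ℝ) (𝓡 d) γ (-t)) (one_smul ℝ (-1 : ℝ))).trans ?_
  exact map_neg (mfderiv 𝓘(ℝ, ℝ) (𝓡 d) γ (-t)) (1 : ℝ)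

theorem velocity_comp {n : ℕ} {P : Type*} [TopologicalSpace P]
    [ChartedSpace (EuclideanSpace ℝ (Fin n)) P] {ι : P → M} {c : ℝ → P} {t : ℝ}
    (hι : MDifferentiableAt (𝓡 n) (𝓡 d) ι (c t)) (hc : MDifferentiableAt 𝓘(ℝ, ℝ) (𝓡 n) c t) :
    velocity (d := d) (fun s ↦ ι (c s)) t =
      mfderiv (𝓡 n) (𝓡 d) ι (c t) (velocity (d := n) c t) :=
  mfderiv_comp_apply t hι hc (1 : ℝ)

variable [IsManifold (𝓡 d) 1 M]

theorem eventually_hasDerivAt_extChartAt_comp {γ : ℝ → M} {t : ℝ}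
    (hγ : ∀ᶠ s in 𝓝 t, MDifferentiableAt 𝓘(ℝ, ℝ) (𝓡 d) γ s) :
    ∀ᶠ s in 𝓝 t, HasDerivAt (fun s ↦ extChartAt (𝓡 d) (γ t) (γ s))
      (fieldCoord γ (fun s ↦ velocity (d := d) γ s) (γ t) s) s := by
  have h : ∀ᶠ s in 𝓝 t, γ s ∈ (chartAt (EuclideanSpace ℝ (Fin d)) (γ t)).source :=
    hγ.self_of_nhds.continuousAt.eventually (chart_source_mem_nhds _ _)
  filter_upwards [h, hγ] with s hs hs' using hasDerivAt_extChartAt_comp hs' hs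

/-- A curve whose velocity is `C^k` is `C^(k+1)`. -/
theorem contMDiffAt_succ_of_velocity {γ : ℝ → M} {t : ℝ} {k : ℕ}
    (hγ : ∀ᶠ s in 𝓝 t, MDifferentiableAt 𝓘(ℝ, ℝ) (𝓡 d) γ s)
    (hv : ContMDiffAt 𝓘(ℝ, ℝ) (𝓡 d).tangent k
      (fun s ↦ (⟨γ s, velocity (d := d) γ s⟩ : TangentBundle (𝓡 d) M)) t) :
    ContMDiffAt 𝓘(ℝ, ℝ) (𝓡 d) (k + 1) γ t := by
  refine contMDiffAt_iff_target.2 ⟨hγ.self_of_nhds.continuousAt, ?_⟩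
  exact (contDiffAt_succ_of_hasDerivAt (eventually_hasDerivAt_extChartAt_comp hγ)
    (contMDiffAt_field_iff.1 hv).2.contDiffAt).contMDiffAt

/-- The velocity of a `C¹` curve is continuous. -/
theorem continuousAt_fieldCoord_velocity {γ : ℝ → M} {t : ℝ}
    (hγ : ContMDiffAt 𝓘(ℝ, ℝ) (𝓡 d) 1 γ t)
    (hγ' : ∀ᶠ s in 𝓝 t, MDifferentiableAt 𝓘(ℝ, ℝ) (𝓡 d) γ s) :
    ContinuousAt (fieldCoord γ (fun s ↦ velocity (d := d) γ s) (γ t)) t := by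
  have h1 : ContDiffAt ℝ 1 (fun s ↦ extChartAt (𝓡 d) (γ t) (γ s)) t :=
    (contMDiffAt_iff_target.1 hγ).2.contDiffAt
  have h2 : ContinuousAt (deriv fun s ↦ extChartAt (𝓡 d) (γ t) (γ s)) t := by
    have := (h1.fderiv_right (m := 0) (by simp)).continuousAt
    exact this.clm_apply continuousAt_const
  refine h2.congr ?_
  filter_upwards [eventually_hasDerivAt_extChartAt_comp hγ'] with s hs
  exact hs.deriv

end Velocity

/-- A curve whose velocity is given by a vector field is an integral curve. -/
theorem isMIntegralCurveAt_of_velocity {n : ℕ} {P : Type*} [TopologicalSpace P]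
    [ChartedSpace (EuclideanSpace ℝ (Fin n)) P] {c : ℝ → P} {t : ℝ}
    {v : (x : P) → TangentSpace (𝓡 n) x}
    (hc : ∀ᶠ s in 𝓝 t, MDifferentiableAt 𝓘(ℝ, ℝ) (𝓡 n) c s)
    (hv : ∀ᶠ s in 𝓝 t, velocity (d := n) c s = v (c s)) :
    IsMIntegralCurveAt (I := 𝓡 n) c v t := by
  filter_upwards [hc, hv] with s h1 h2
  refine h1.hasMFDerivAt.congr_mfderiv ?_
  refine ContinuousLinearMap.ext_ring ?_
  refine h2.trans ?_
  exact (one_smul ℝ (v (c s))).symm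

/-! ### Ruling curves obey a curve law. -/

section Ruling

variable {n : ℕ} {M : Type*} [TopologicalSpace M]
  [ChartedSpace (EuclideanSpace ℝ (Fin (n + 1))) M] [IsManifold (𝓡 (n + 1)) ∞ M]
  {S : SubRiemannianStructure (n + 1) M} (V : VerticallyRigidStructure S)
  {P : Type*} [TopologicalSpace P]
  [ChartedSpace (EuclideanSpace ℝ (Fin n)) P] [IsManifold (𝓡 n) 2 P]
  (ι : P → M) (ν : (x : P) → TangentSpace (𝓡 (n + 1)) (ι x))

/-- The image of `u` is a horizontal unit vector orthogonal to `ν`. -/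
structure IsRulingVector (x : P) (u : TangentSpace (𝓡 n) x) : Prop where
  horizontal : mfderiv (𝓡 n) (𝓡 (n + 1)) ι x u ∈ S.horizontal (ι x)
  unit : V.metric.inner (ι x) (mfderiv (𝓡 n) (𝓡 (n + 1)) ι x u)
    (mfderiv (𝓡 n) (𝓡 (n + 1)) ι x u) = 1
  orthogonal : V.metric.inner (ι x) (mfderiv (𝓡 n) (𝓡 (n + 1)) ι x u) (ν x) = 0

/-- At time `t` the curve `c` is `C¹` with ruling velocity. -/
structure IsRulingAt (c : ℝ → P) (t : ℝ) : Prop where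
  contMDiffAt : ContMDiffAt 𝓘(ℝ, ℝ) (𝓡 n) 1 c t
  velocity : IsRulingVector V ι ν (c t) (velocity (d := n) c t)

variable {V ι ν} {x : P} {u u' : TangentSpace (𝓡 n) x} {c c' : ℝ → P} {t : ℝ}

omit [IsManifold (𝓡 n) 2 P] in
theorem IsRulingAt.mdifferentiableAt (h : IsRulingAt V ι ν c t) :
    MDifferentiableAt 𝓘(ℝ, ℝ) (𝓡 n) c t :=
  h.contMDiffAt.mdifferentiableAt one_ne_zero

/-- J is open and the velocity of ι ∘ c is the image of that of c, so being a ruling curve is a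
condition at each time separately. This is the form to which the abstract foliation argument
applies. -/
theorem isRulingCurve_iff (hp : IsNoncharacteristicPatch (n := n) V ι ν) {J : Set ℝ} :
    IsRulingCurve (n := n) V ι ν c J ↔ IsLawfulCurve (IsRulingAt V ι ν) c J := by
  have hι : ∀ x, MDifferentiableAt (𝓡 n) (𝓡 (n + 1)) ι x := fun x ↦
    (hp.contMDiff x).mdifferentiableAt two_ne_zero
  constructor
  · intro h
    refine ⟨h.isOpen, h.ordConnected, h.nonempty, fun t ht ↦ ?_⟩
    have h1 : ContMDiffAt 𝓘(ℝ, ℝ) (𝓡 n) 1 c t :=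
      (h.contMDiffOn t ht).contMDiffAt (h.isOpen.mem_nhds ht)
    have h2 := velocity_comp (hι (c t)) (h1.mdifferentiableAt one_ne_zero)
    refine ⟨h1, ?_, ?_, ?_⟩
    · rw [← h2]
      exact h.horizontal t ht
    · rw [← h2]
      exact h.unit_speed t ht
    · rw [← h2]
      exact h.orthogonal t ht
  · intro h
    have h2 := fun t ht ↦ velocity_comp (hι (c t)) (h.law t ht).mdifferentiableAt
    refine ⟨h.isOpen, h.ordConnected, h.nonempty,
      fun t ht ↦ (h.law t ht).contMDiffAt.contMDiffWithinAt, fun t ht ↦ ?_, fun t ht ↦ ?_,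
      fun t ht ↦ ?_⟩
    · rw [h2 t ht]
      exact (h.law t ht).velocity.horizontal
    · rw [h2 t ht]
      exact (h.law t ht).velocity.unit
    · rw [h2 t ht]
      exact (h.law t ht).velocity.orthogonal

omit [IsManifold (𝓡 n) 2 P] in
theorem IsRulingVector.neg (h : IsRulingVector V ι ν x u) : IsRulingVector V ι ν x (-u) := by
  obtain ⟨h1, h2, h3⟩ := h
  have e : mfderiv (𝓡 n) (𝓡 (n + 1)) ι x (-u) =
      (-1 : ℝ) • mfderiv (𝓡 n) (𝓡 (n + 1)) ι x u := by rw [map_neg, neg_one_smul]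
  refine ⟨?_, ?_, ?_⟩
  · rw [e]
    exact Submodule.smul_mem _ _ h1
  · rw [e, metric_smul_left, metric_smul_right, h2]
    norm_num
  · rw [e, metric_smul_left, h3, mul_zero]

omit [IsManifold (𝓡 n) 2 P] in
theorem IsRulingVector.ne_zero (h : IsRulingVector V ι ν x u) : u ≠ 0 := by
  rintro rfl
  have := h.unit
  rw [map_zero, map_zero] at this
  exact zero_ne_one this

theorem IsRulingVector.eq_or_eq_neg (hrank : S.rank = 2)
    (hp : IsNoncharacteristicPatch (n := n) V ι ν) (h : IsRulingVector V ι ν x u)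
    (h' : IsRulingVector V ι ν x u') : u' = u ∨ u' = -u := by
  have h1 := eq_of_mem_plane V.metric (by rw [S.finrank_horizontal, hrank]) h.horizontal
    (hp.normal_horizontal x) h'.horizontal h.unit (hp.normal_unit x) h.orthogonal
  rw [h'.orthogonal, zero_smul, add_zero] at h1
  generalize V.metric.inner (ι x) (mfderiv (𝓡 n) (𝓡 (n + 1)) ι x u')
    (mfderiv (𝓡 n) (𝓡 (n + 1)) ι x u) = a at h1
  have h2 := h'.unit
  rw [h1, metric_smul_left, metric_smul_right, h.unit, mul_one] at h2
  rcases mul_self_eq_one_iff.1 h2 with rfl | rfl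
  · left
    exact hp.immersive x (h1.trans (one_smul _ _))
  · right
    refine hp.immersive x (h1.trans ?_)
    rw [map_neg, neg_one_smul]

/-- The velocity of a ruling curve agrees, up to a constant sign, with a given ruling field. -/
theorem eventually_velocity_eq_or_eq_neg (hrank : S.rank = 2)
    (hp : IsNoncharacteristicPatch (n := n) V ι ν) {v : (x : P) → TangentSpace (𝓡 n) x}
    (hc : ∀ᶠ s in 𝓝 t, IsRulingAt V ι ν c s)
    (hv : ∀ᶠ x in 𝓝 (c t), IsRulingVector V ι ν x (v x))
    (hvc : ContMDiffAt (𝓡 n) (𝓡 n).tangent 1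
      (fun x ↦ (⟨x, v x⟩ : TangentBundle (𝓡 n) P)) (c t)) :
    (∀ᶠ s in 𝓝 t, velocity (d := n) c s = v (c s)) ∨
      ∀ᶠ s in 𝓝 t, velocity (d := n) c s = -v (c s) := by
  have hct := hc.self_of_nhds
  have hcont : ContinuousAt c t := hct.contMDiffAt.continuousAt
  set X := fieldCoord c (fun s ↦ velocity (d := n) c s) (c t) with hX
  set Z := fieldCoord c (fun s ↦ v (c s)) (c t) with hZ
  have hXc : ContinuousAt X t := continuousAt_fieldCoord_velocity hct.contMDiffAt
    (hc.mono fun s hs ↦ hs.mdifferentiableAt)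
  have hZc : ContinuousAt Z t :=
    ((contMDiffAt_field_iff (f := fun x ↦ x)).1 hvc).2.continuousAt.comp hcont
  have hbase := eventually_mem_baseSet (d := n) hcont
  have hev : ∀ᶠ s in 𝓝 t, (velocity (d := n) c s = v (c s) ∧ X s = Z s ∨
      velocity (d := n) c s = -v (c s) ∧ X s = -Z s) := by
    filter_upwards [hc, hcont.eventually hv, hbase] with s h1 h2 h3
    rw [hX, hZ, fieldCoord_eq _ h3, fieldCoord_eq _ h3]
    refine (h2.eq_or_eq_neg hrank hp h1.velocity).imp (fun h ↦ ⟨h, by rw [h]⟩) fun h ↦ ⟨h, ?_⟩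
    rw [h]
    exact map_neg _ _
  have hZ0 : Z t ≠ 0 := by
    rw [hZ, fieldCoord_eq _ hbase.self_of_nhds]
    intro h
    exact hv.self_of_nhds.ne_zero ((map_eq_zero_iff _ (ContinuousLinearEquiv.injective _)).1 h)
  -- The sign is read off from the Euclidean inner product of the two coordinate vectors: it is
  -- continuous and nonzero at t, so the sign is locally constant.
  have hpos : 0 < inner ℝ (Z t) (Z t) := real_inner_self_pos.2 hZ0
  have hin : ContinuousAt (fun s ↦ inner ℝ (X s) (Z s)) t := hXc.inner hZc
  rcases hev.self_of_nhds with ⟨-, h⟩ | ⟨-, h⟩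
  · left
    have h1 : ∀ᶠ s in 𝓝 t, 0 < inner ℝ (X s) (Z s) :=
      hin.eventually (lt_mem_nhds (by beta_reduce; rwa [h]))
    filter_upwards [hev, h1] with s h2 h3
    rcases h2 with ⟨h2, -⟩ | ⟨-, h2⟩
    · exact h2
    · rw [h2, inner_neg_left] at h3
      linarith [real_inner_self_nonneg (x := Z s)]
  · right
    have h1 : ∀ᶠ s in 𝓝 t, inner ℝ (X s) (Z s) < 0 :=
      hin.eventually (gt_mem_nhds (by beta_reduce; rw [h, inner_neg_left]; linarith))
    filter_upwards [hev, h1] with s h2 h3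
    rcases h2 with ⟨-, h2⟩ | ⟨h2, -⟩
    · rw [h2] at h3
      linarith [real_inner_self_nonneg (x := Z s)]
    · exact h2

omit [IsManifold (𝓡 n) 2 P] in
theorem IsRulingAt.congr (h : IsRulingAt V ι ν c t) (hcc' : c =ᶠ[𝓝 t] c') :
    IsRulingAt V ι ν c' t := by
  refine ⟨h.contMDiffAt.congr_of_eventuallyEq hcc'.symm, ?_⟩
  -- The base points are only propositionally equal; viewing tangent vectors in the model space
  -- allows the transport.
  have key : ∀ (x y : P) (_ : x = y) (u : EuclideanSpace ℝ (Fin n)),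
      IsRulingVector V ι ν x u → IsRulingVector V ι ν y u := by
    rintro x _ rfl u hu
    exact hu
  have h1 := key _ _ hcc'.self_of_nhds _ h.velocity
  have h2 : (SubRiemannianGeometry.velocity (d := n) c' t : EuclideanSpace ℝ (Fin n)) =
      SubRiemannianGeometry.velocity (d := n) c t :=
    congrArg (fun A : ℝ →L[ℝ] EuclideanSpace ℝ (Fin n) ↦ A 1) hcc'.symm.mfderiv_eq
  exact h2 ▸ h1

omit [IsManifold (𝓡 n) 2 P] in
theorem IsRulingAt.translate {b : ℝ} (h : IsRulingAt V ι ν c (b + t)) :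
    IsRulingAt V ι ν (fun s ↦ c (b + s)) t := by
  refine ⟨?_, ?_⟩
  · have h1 : ContMDiffAt 𝓘(ℝ, ℝ) 𝓘(ℝ, ℝ) 1 (fun s : ℝ ↦ b + s) t :=
      (contDiff_const.add contDiff_id).contDiffAt.contMDiffAt
    exact ContMDiffAt.comp (f := fun s : ℝ ↦ b + s) t h.contMDiffAt h1
  · rw [velocity_const_add h.mdifferentiableAt]
    exact h.velocity

omit [IsManifold (𝓡 n) 2 P] in
theorem IsRulingAt.reflect (h : IsRulingAt V ι ν c (-t)) :
    IsRulingAt V ι ν (fun s ↦ c (-s)) t := by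
  refine ⟨?_, ?_⟩
  · have h1 : ContMDiffAt 𝓘(ℝ, ℝ) 𝓘(ℝ, ℝ) 1 (fun s : ℝ ↦ -s) t :=
      contDiff_neg.contDiffAt.contMDiffAt
    exact ContMDiffAt.comp (f := fun s : ℝ ↦ -s) t h.contMDiffAt h1
  · rw [velocity_neg h.mdifferentiableAt]
    exact h.velocity.neg

/-- In a chart, the difference of c and its reversal has derivative twice the velocity at 0, which
is nonzero. Hence its zero at 0 is isolated. -/
theorem IsRulingAt.eventually_eq_zero_of_eq_reflect (h : IsRulingAt V ι ν c 0) :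
    ∀ᶠ s in 𝓝 (0 : ℝ), c s = c (-s) → s = 0 := by
  set f : ℝ → EuclideanSpace ℝ (Fin n) := fun s ↦ extChartAt (𝓡 n) (c 0) (c s) with hf
  have h1 : HasDerivAt f _ 0 :=
    hasDerivAt_extChartAt_comp h.mdifferentiableAt (mem_chart_source _ (c 0))
  set D := fieldCoord c (fun s ↦ SubRiemannianGeometry.velocity (d := n) c s) (c 0) 0 with hD
  have hD0 : D ≠ 0 := by
    rw [hD, fieldCoord_eq _ (mem_trivializationAt_baseSet (c 0))]
    intro h2
    exact h.velocity.ne_zero ((map_eq_zero_iff _ (ContinuousLinearEquiv.injective _)).1 h2)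
  have h2 : HasDerivAt (fun s ↦ f (-s)) (-D) 0 := by
    have h3 : HasDerivAt f D (-0) := by rwa [neg_zero]
    exact (HasDerivAt.scomp (0 : ℝ) h3 (hasDerivAt_neg (0 : ℝ))).congr_deriv (neg_one_smul ℝ D)
  have h3 : HasDerivAt (fun s ↦ f s - f (-s)) (D - -D) 0 := h1.sub h2
  have h4 : D - -D ≠ 0 := by
    rw [sub_neg_eq_add, ← two_smul ℝ D]
    exact smul_ne_zero two_ne_zero hD0
  have h5 := eventually_nhdsWithin_iff.1 (h3.eventually_ne (c := 0) h4)
  filter_upwards [h5] with s hs hcs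
  by_contra h6
  refine hs h6 ?_
  simp only [hf]
  rw [← hcs, sub_self]

/-- Ruling curves through a point are locally unique up to reversal. -/
theorem eventually_eq_or_eq_reflect [T2Space P] (hrank : S.rank = 2)
    (hp : IsNoncharacteristicPatch (n := n) V ι ν) (hc : ∀ᶠ s in 𝓝 0, IsRulingAt V ι ν c s)
    (hc' : ∀ᶠ s in 𝓝 0, IsRulingAt V ι ν c' s) (h0 : c 0 = c' 0) :
    (∀ᶠ s in 𝓝 0, c s = c' s) ∨ ∀ᶠ s in 𝓝 0, c s = c' (-s) := by
  obtain ⟨v, O, hO, hxO, hv⟩ := exists_local_ruling_field hrank hp (c 0)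
  have hvr : ∀ᶠ x in 𝓝 (c 0), IsRulingVector V ι ν x (v x) := by
    filter_upwards [hO.mem_nhds hxO] with x hx using ⟨(hv x hx).2.2.1, (hv x hx).2.2.2.1,
      (hv x hx).2.2.2.2⟩
  have hvc := (hv _ hxO).1
  have hvc' : ContMDiffAt (𝓡 n) (𝓡 n).tangent 1
      (fun x ↦ (⟨x, -v x⟩ : TangentBundle (𝓡 n) P)) (c 0) := by
    have := contMDiffAt_field_smul (f := fun x : P ↦ x) (a := fun _ ↦ (-1 : ℝ))
      contMDiffAt_const hvc
    simpa using this
  have hneg : Filter.Tendsto (fun s : ℝ ↦ -s) (𝓝 0) (𝓝 0) := by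
    simpa using (continuous_neg (G := ℝ)).tendsto 0
  have hc'' : ∀ᶠ s in 𝓝 0, IsRulingAt V ι ν (fun s ↦ c' (-s)) s := by
    filter_upwards [hneg.eventually hc'] with s hs using hs.reflect
  have hm : ∀ {c : ℝ → P}, (∀ᶠ s in 𝓝 0, IsRulingAt V ι ν c s) →
      ∀ᶠ s in 𝓝 0, MDifferentiableAt 𝓘(ℝ, ℝ) (𝓡 n) c s :=
    fun h ↦ h.mono fun s hs ↦ hs.mdifferentiableAt
  have hrefl : ∀ {w : (x : P) → TangentSpace (𝓡 n) x},
      (∀ᶠ s in 𝓝 0, velocity (d := n) c' s = w (c' s)) →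
      ∀ᶠ s in 𝓝 0, velocity (d := n) (fun s ↦ c' (-s)) s = -w (c' (-s)) := by
    intro w hw
    filter_upwards [hneg.eventually hw, hneg.eventually (hm hc')] with s h1 h2
    rw [velocity_neg h2, h1]
  have h0' : c 0 = c' (-0) := by rw [neg_zero, h0]
  -- Each curve follows v or -v. With equal signs they are integral curves of the same field; with
  -- opposite signs, reversing c' makes them so. Uniqueness of integral curves then applies.
  rcases eventually_velocity_eq_or_eq_neg hrank hp hc hvr hvc with h1 | h1 <;>
    rcases eventually_velocity_eq_or_eq_neg hrank hp hc' (h0 ▸ hvr) (h0 ▸ hvc) with h2 | h2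
  · left
    exact isMIntegralCurveAt_eventuallyEq_of_contMDiffAt_boundaryless hvc
      (isMIntegralCurveAt_of_velocity (hm hc) h1) (isMIntegralCurveAt_of_velocity (hm hc') h2) h0
  · right
    have h3 := hrefl (w := fun x ↦ -v x) h2
    simp only [neg_neg] at h3
    exact isMIntegralCurveAt_eventuallyEq_of_contMDiffAt_boundaryless hvc
      (isMIntegralCurveAt_of_velocity (hm hc) h1)
      (isMIntegralCurveAt_of_velocity (hm hc'') h3) h0'
  · right
    exact isMIntegralCurveAt_eventuallyEq_of_contMDiffAt_boundaryless hvc'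
      (isMIntegralCurveAt_of_velocity (v := fun x ↦ -v x) (hm hc) h1)
      (isMIntegralCurveAt_of_velocity (v := fun x ↦ -v x) (hm hc'') (hrefl h2)) h0'
  · left
    exact isMIntegralCurveAt_eventuallyEq_of_contMDiffAt_boundaryless hvc'
      (isMIntegralCurveAt_of_velocity (v := fun x ↦ -v x) (hm hc) h1)
      (isMIntegralCurveAt_of_velocity (v := fun x ↦ -v x) (hm hc') h2) h0

theorem isCurveLaw_isRulingAt [T2Space P] (hrank : S.rank = 2)
    (hp : IsNoncharacteristicPatch (n := n) V ι ν) : IsCurveLaw (IsRulingAt V ι ν) where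
  congr h h' := h'.congr h
  translate h := h.translate
  reflect h := h.reflect
  continuousAt h := h.contMDiffAt.continuousAt
  eq_or_eq_neg := eventually_eq_or_eq_reflect hrank hp
  eventually_ne h := h.self_of_nhds.eventually_eq_zero_of_eq_reflect

end Ruling

/-! ### Ruling curves of minimal patches are geodesics. -/

section Geodesic

variable {n : ℕ} {M : Type*} [TopologicalSpace M]
  [ChartedSpace (EuclideanSpace ℝ (Fin (n + 1))) M] [IsManifold (𝓡 (n + 1)) ∞ M]
  {S : SubRiemannianStructure (n + 1) M} {V : VerticallyRigidStructure S}
  {cov : TangentConnection (n + 1) M}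

/-- A vector orthogonal to the vertical frame and to a horizontal orthonormal pair vanishes. -/
theorem eq_zero_of_metric_eq_zero (hrank : S.rank = 2) {p : M}
    {u v Y : TangentSpace (𝓡 (n + 1)) p} (hu : u ∈ S.horizontal p) (hv : v ∈ S.horizontal p)
    (huu : V.metric.inner p u u = 1) (hvv : V.metric.inner p v v = 1)
    (huv : V.metric.inner p u v = 0) (hYu : V.metric.inner p Y u = 0)
    (hYv : V.metric.inner p Y v = 0) (hYT : ∀ j, V.metric.inner p Y (V.frame j p) = 0) :
    Y = 0 := by
  obtain ⟨a, ha, b, hb, rfl⟩ : ∃ a ∈ S.horizontal p, ∃ b ∈ V.vertical p, a + b = Y := by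
    rw [← Submodule.mem_sup, (V.isCompl p).sup_eq_top]
    trivial
  have hbh : ∀ w ∈ S.horizontal p, V.metric.inner p b w = 0 := fun w hw ↦ by
    rw [V.metric.symm]
    exact V.metric_orthogonal p w hw b hb
  -- The horizontal part of Y does not contribute against the frame, so the vertical part b is
  -- orthogonal to all of the vertical space, hence to itself.
  have hbT : ∀ w ∈ V.vertical p, V.metric.inner p b w = 0 := by
    intro w hw
    rw [← V.span_frame p] at hw
    have hle : Submodule.span ℝ (range fun i ↦ V.frame i p) ≤
        LinearMap.ker (V.metric.inner p b).toLinearMap := by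
      rw [Submodule.span_le]
      rintro _ ⟨j, rfl⟩
      have h1 := hYT j
      rw [metric_add_left, V.metric_orthogonal p a ha _ (by
        rw [← V.span_frame p]
        exact Submodule.subset_span ⟨j, rfl⟩), zero_add] at h1
      exact h1
    exact hle hw
  have hb0 : b = 0 := by
    by_contra h
    exact (metric_self_pos V.metric h).ne' (hbT b hb)
  subst hb0
  rw [add_zero] at hYu hYv ⊢
  have h1 := eq_of_mem_plane V.metric (by rw [S.finrank_horizontal, hrank]) hu hv ha huu hvv huv
  rw [hYu, hYv, zero_smul, zero_smul, add_zero] at h1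
  exact h1

variable {P : Type*} [TopologicalSpace P]
  [ChartedSpace (EuclideanSpace ℝ (Fin n)) P] [IsManifold (𝓡 n) 2 P]
  {ι : P → M} {ν : (x : P) → TangentSpace (𝓡 (n + 1)) (ι x)}

theorem IsRulingVector.isHorizontalFrame (hrank : S.rank = 2)
    (hp : IsNoncharacteristicPatch (n := n) V ι ν) {x : P} {u : TangentSpace (𝓡 n) x}
    (h : IsRulingVector V ι ν x u) :
    IsHorizontalFrame (n := n) V ι x (fun _ : Fin 1 ↦ u) := by
  refine ⟨fun i j ↦ ?_, ?_⟩
  · rw [Subsingleton.elim i j, if_pos rfl]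
    exact h.unit
  · rw [range_const]
    apply le_antisymm
    · rw [Submodule.span_singleton_le_iff_mem]
      exact ⟨h.horizontal, u, rfl⟩
    · rintro w ⟨hw, hwt⟩
      have h1 := eq_of_mem_plane V.metric (by rw [S.finrank_horizontal, hrank]) h.horizontal
        (hp.normal_horizontal x) hw h.unit (hp.normal_unit x) h.orthogonal
      rw [metric_normal_eq_zero hp hw hwt, zero_smul, add_zero] at h1
      rw [h1]
      exact Submodule.smul_mem _ _ (Submodule.mem_span_singleton_self _)

/-- On a minimal patch `∇_u ν ⟂ u` for the ruling vectors `u`. -/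
theorem IsMinimal.metric_covAlong_eq_zero (hrank : S.rank = 2)
    (hp : IsNoncharacteristicPatch (n := n) V ι ν) (hmin : IsMinimal (n := n) V cov ι ν) {x : P}
    {u : TangentSpace (𝓡 n) x} (h : IsRulingVector V ι ν x u) :
    V.metric.inner (ι x) (covAlong cov (𝓡 n) ι ν x u)
      (mfderiv (𝓡 n) (𝓡 (n + 1)) ι x u) = 0 := by
  have h1 := hmin x 1 _ (h.isHorizontalFrame hrank hp)
  rw [Matrix.trace_fin_one] at h1
  exact h1

variable {c : ℝ → P} {t : ℝ}

/-- Near t the velocity is a constant sign times the C¹ ruling field evaluated along c. This gains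
one derivative over the assumed C¹ regularity of c. -/
theorem contMDiffAt_velocity_ruling (hrank : S.rank = 2)
    (hp : IsNoncharacteristicPatch (n := n) V ι ν) (hc : ∀ᶠ s in 𝓝 t, IsRulingAt V ι ν c s) :
    ContMDiffAt 𝓘(ℝ, ℝ) (𝓡 (n + 1)).tangent 1 (fun s ↦ (⟨ι (c s),
      velocity (d := n + 1) (fun s ↦ ι (c s)) s⟩ : TangentBundle (𝓡 (n + 1)) M)) t := by
  obtain ⟨v, O, hO, hxO, hv⟩ := exists_local_ruling_field hrank hp (c t)
  have hvr : ∀ᶠ x in 𝓝 (c t), IsRulingVector V ι ν x (v x) := by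
    filter_upwards [hO.mem_nhds hxO] with x hx using ⟨(hv x hx).2.2.1, (hv x hx).2.2.2.1,
      (hv x hx).2.2.2.2⟩
  have hι : ∀ x, MDifferentiableAt (𝓡 n) (𝓡 (n + 1)) ι x := fun x ↦
    (hp.contMDiff x).mdifferentiableAt two_ne_zero
  have hw : ContMDiffAt 𝓘(ℝ, ℝ) (𝓡 (n + 1)).tangent 1 (fun s ↦ (⟨ι (c s),
      mfderiv (𝓡 n) (𝓡 (n + 1)) ι (c s) (v (c s))⟩ : TangentBundle (𝓡 (n + 1)) M)) t :=
    (hv _ hxO).2.1.comp t hc.self_of_nhds.contMDiffAt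
  obtain ⟨a, ha⟩ : ∃ a : ℝ, ∀ᶠ s in 𝓝 t, velocity (d := n) c s = a • v (c s) := by
    rcases eventually_velocity_eq_or_eq_neg hrank hp hc hvr (hv _ hxO).1 with h | h
    · exact ⟨1, h.mono fun s hs ↦ by rw [hs, one_smul]⟩
    · exact ⟨-1, h.mono fun s hs ↦ by rw [hs, neg_one_smul]⟩
  refine (contMDiffAt_field_smul (a := fun _ ↦ a) contMDiffAt_const hw).congr_of_eventuallyEq ?_
  filter_upwards [ha, hc] with s h1 h2
  rw [velocity_comp (hι _) h2.mdifferentiableAt, h1, map_smul]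

/-- Ruling curves of minimal patches are geodesics. -/
theorem covAlong_velocity_ruling_eq_zero (hrank : S.rank = 2) (hcov : IsAdapted V cov)
    (hp : IsNoncharacteristicPatch (n := n) V ι ν) (hmin : IsMinimal (n := n) V cov ι ν)
    (hc : ∀ᶠ s in 𝓝 t, IsRulingAt V ι ν c s) :
    covAlong cov 𝓘(ℝ, ℝ) (fun s ↦ ι (c s))
      (fun s ↦ velocity (d := n + 1) (fun s ↦ ι (c s)) s) t (1 : ℝ) = 0 := by
  have hι : ∀ x, MDifferentiableAt (𝓡 n) (𝓡 (n + 1)) ι x := fun x ↦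
    (hp.contMDiff x).mdifferentiableAt two_ne_zero
  set γ : ℝ → M := fun s ↦ ι (c s) with hγ
  set X : (s : ℝ) → TangentSpace (𝓡 (n + 1)) (γ s) := fun s ↦ velocity (d := n + 1) γ s with hX
  have hct := hc.self_of_nhds
  have hXd : MDifferentiableAt 𝓘(ℝ, ℝ) (𝓡 (n + 1)).tangent
      (fun s ↦ (⟨γ s, X s⟩ : TangentBundle (𝓡 (n + 1)) M)) t :=
    (contMDiffAt_velocity_ruling hrank hp hc).mdifferentiableAt one_ne_zero
  have hγd : MDifferentiableAt 𝓘(ℝ, ℝ) (𝓡 (n + 1)) γ t :=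
    (hι _).comp t hct.mdifferentiableAt
  have hνd : MDifferentiableAt 𝓘(ℝ, ℝ) (𝓡 (n + 1)).tangent
      (fun s ↦ (⟨γ s, ν (c s)⟩ : TangentBundle (𝓡 (n + 1)) M)) t :=
    MDifferentiableAt.comp t ((hp.normal_contMDiff (c t)).mdifferentiableAt one_ne_zero)
      hct.mdifferentiableAt
  have hTd : ∀ j q, MDifferentiableAt (𝓡 (n + 1)) (𝓡 (n + 1)).tangent
      (fun q ↦ (⟨q, V.frame j q⟩ : TangentBundle (𝓡 (n + 1)) M)) q := fun j q ↦
    ((V.frame_smooth j q (mem_univ q)).contMDiffAt Filter.univ_mem).mdifferentiableAt (by simp)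
  have hTγd : ∀ j, MDifferentiableAt 𝓘(ℝ, ℝ) (𝓡 (n + 1)).tangent
      (fun s ↦ (⟨γ s, V.frame j (γ s)⟩ : TangentBundle (𝓡 (n + 1)) M)) t := fun j ↦
    MDifferentiableAt.comp t (hTd j (γ t)) hγd
  have hXv : ∀ᶠ s in 𝓝 t, X s ∈ S.horizontal (γ s) ∧ V.metric.inner (γ s) (X s) (X s) = 1 ∧
      V.metric.inner (γ s) (X s) (ν (c s)) = 0 := by
    filter_upwards [hc] with s hs
    have h1 : X s = mfderiv (𝓡 n) (𝓡 (n + 1)) ι (c s) (velocity (d := n) c s) :=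
      velocity_comp (hι _) hs.mdifferentiableAt
    rw [h1]
    exact ⟨hs.velocity.horizontal, hs.velocity.unit, hs.velocity.orthogonal⟩
  obtain ⟨hXh, hXX, hXν⟩ := hXv.self_of_nhds
  have hconst : ∀ {f : ℝ → ℝ} {f' a : ℝ}, HasDerivAt f f' t → (∀ᶠ s in 𝓝 t, f s = a) → f' = 0 :=
    fun h h' ↦ h.unique ((hasDerivAt_const t _).congr_of_eventuallyEq h')
  -- Derivatives of the constants ⟨X, X⟩ = 1, ⟨X, ν⟩ = 0 and ⟨X, T_j⟩ = 0.
  have h1 := hconst (hasDerivAt_metric_along V.metric cov hcov.metric_compatible hXd hXd)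
    (hXv.mono fun s hs ↦ hs.2.1)
  have h2 := hconst (hasDerivAt_metric_along V.metric cov hcov.metric_compatible hXd hνd)
    (hXv.mono fun s hs ↦ hs.2.2)
  have h3 := fun j ↦ hconst
    (hasDerivAt_metric_along V.metric cov hcov.metric_compatible hXd (hTγd j))
    (hXv.mono fun s hs ↦ V.metric_orthogonal (γ s) (X s) hs.1 (V.frame j (γ s)) (by
      rw [← V.span_frame]
      exact Submodule.subset_span ⟨j, rfl⟩))
  -- The chain rule turns the derivative of ν along γ into its derivative on the patch, where
  -- minimality applies.
  have hνX : V.metric.inner (γ t) (X t)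
      (covAlong cov 𝓘(ℝ, ℝ) γ (fun s ↦ ν (c s)) t (1 : ℝ)) = 0 := by
    have h4 : covAlong cov 𝓘(ℝ, ℝ) γ (fun s ↦ ν (c s)) t (1 : ℝ) =
        covAlong cov (𝓡 n) ι ν (c t) (velocity (d := n) c t) :=
      covAlong_comp cov hct.mdifferentiableAt
        ((hp.normal_contMDiff (c t)).mdifferentiableAt one_ne_zero) (1 : ℝ)
    have h5 : X t = mfderiv (𝓡 n) (𝓡 (n + 1)) ι (c t) (velocity (d := n) c t) :=
      velocity_comp (hι _) hct.mdifferentiableAt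
    rw [h4, h5, V.metric.symm]
    exact hmin.metric_covAlong_eq_zero hrank hp hct.velocity
  have hTX : ∀ j, covAlong cov 𝓘(ℝ, ℝ) γ (fun s ↦ V.frame j (γ s)) t (1 : ℝ) = 0 := by
    intro j
    have h4 := covAlong_restrict cov hγd (hTd j (γ t)) (1 : ℝ)
    rw [hcov.parallel] at h4
    exact h4
  refine eq_zero_of_metric_eq_zero (V := V) hrank hXh (hp.normal_horizontal (c t)) hXX
    (hp.normal_unit (c t)) hXν ?_ ?_ fun j ↦ ?_
  · rw [V.metric.symm (γ t) (X t)] at h1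
    linarith
  · rw [hνX, add_zero] at h2
    exact h2
  · have h4 := h3 j
    rw [hTX, map_zero, add_zero] at h4
    exact h4

theorem IsRulingCurve.isGeodesicOn (hrank : S.rank = 2) (hcov : IsAdapted V cov)
    (hp : IsNoncharacteristicPatch (n := n) V ι ν) (hmin : IsMinimal (n := n) V cov ι ν)
    {J : Set ℝ} (h : IsRulingCurve (n := n) V ι ν c J) :
    IsGeodesicOn cov (fun t ↦ ι (c t)) J := by
  have h' := (isRulingCurve_iff hp).1 h
  refine ⟨fun t ht ↦ ?_, fun t ht ↦
    covAlong_velocity_ruling_eq_zero hrank hcov hp hmin (h'.eventually ht)⟩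
  have hd : ∀ᶠ s in 𝓝 t, MDifferentiableAt 𝓘(ℝ, ℝ) (𝓡 (n + 1)) (fun t ↦ ι (c t)) s :=
    (h'.eventually ht).mono fun s hs ↦
      ((hp.contMDiff (c s)).mdifferentiableAt two_ne_zero).comp s hs.mdifferentiableAt
  have h2 := contMDiffAt_succ_of_velocity (k := 1) hd (by
    exact_mod_cast contMDiffAt_velocity_ruling hrank hp (h'.eventually ht))
  have h3 : (((1 : ℕ) : WithTop ℕ∞) + 1) = 2 := by norm_num
  rw [h3] at h2
  exact h2.contMDiffWithinAt

end Geodesic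

/-! ### Flow boxes on a manifold. -/

section FlowBoxManifold

variable {n : ℕ} {P : Type*} [TopologicalSpace P]
  [ChartedSpace (EuclideanSpace ℝ (Fin n)) P] [IsManifold (𝓡 n) 1 P]

/-- A `C¹` vector field on a manifold has a flow box near each point where it does not vanish. -/
theorem exists_flow_box_manifold {v : (x : P) → TangentSpace (𝓡 n) x} {x₀ : P}
    (hv : ContMDiffAt (𝓡 n) (𝓡 n).tangent 1 (fun x ↦ (⟨x, v x⟩ : TangentBundle (𝓡 n) P)) x₀)
    (hv₀ : v x₀ ≠ 0) {O : Set P} (hO : O ∈ 𝓝 x₀) :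
    ∃ (φ : OpenPartialHomeomorph P (ℝ × EuclideanSpace ℝ (Fin (n - 1))))
      (ε : ℝ) (U : Set (EuclideanSpace ℝ (Fin (n - 1)))),
      x₀ ∈ φ.source ∧ 0 < ε ∧ φ.target = Ioo (-ε) ε ×ˢ U ∧
      ∀ y ∈ U, ∀ t ∈ Ioo (-ε) ε, φ.symm (t, y) ∈ O ∧
        ContMDiffAt 𝓘(ℝ, ℝ) (𝓡 n) 1 (fun t ↦ φ.symm (t, y)) t ∧
        velocity (d := n) (fun t ↦ φ.symm (t, y)) t = v (φ.symm (t, y)) := by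
  set ψ := chartAt (EuclideanSpace ℝ (Fin n)) x₀ with hψ
  have hx₀ : x₀ ∈ ψ.source := mem_chart_source _ x₀
  have hz₀ : ψ x₀ ∈ ψ.target := ψ.map_source hx₀
  have hsymm : ∀ z ∈ ψ.target, ContMDiffAt 𝓘(ℝ, EuclideanSpace ℝ (Fin n)) (𝓡 n) 1 ψ.symm z :=
    fun z hz ↦ (contMDiffOn_chart_symm z hz).contMDiffAt (ψ.open_target.mem_nhds hz)
  let F : EuclideanSpace ℝ (Fin n) → EuclideanSpace ℝ (Fin n) :=
    fun z ↦ sectionCoord v x₀ (ψ.symm z)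
  have hF : ContDiffAt ℝ 1 F (ψ x₀) := by
    have h1 : ContMDiffAt (𝓡 n) 𝓘(ℝ, EuclideanSpace ℝ (Fin n)) 1 (sectionCoord v x₀)
        (ψ.symm (ψ x₀)) := by
      rw [ψ.left_inv hx₀]
      exact ((contMDiffAt_field_iff (f := fun x ↦ x)).1 hv).2
    exact (h1.comp (ψ x₀) (hsymm _ hz₀)).contDiffAt
  have hF₀ : F (ψ x₀) ≠ 0 := by
    simp only [F]
    rw [ψ.left_inv hx₀, sectionCoord_eq _ (mem_trivializationAt_baseSet x₀)]
    intro h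
    exact hv₀ ((map_eq_zero_iff _ (ContinuousLinearEquiv.injective _)).1 h)
  have hW : ∀ᶠ z in 𝓝 (ψ x₀), z ∈ ψ.target ∧ ContDiffAt ℝ 1 F z ∧ ψ.symm z ∈ O := by
    refine Filter.Eventually.and (ψ.open_target.mem_nhds hz₀)
      (Filter.Eventually.and (hF.eventually (by simp)) ?_)
    exact (ψ.continuousAt_symm hz₀) (by rwa [ψ.left_inv hx₀])
  obtain ⟨Ψ, ε, U, hε, hsrc, hΨ₀, hΨW, hΨ⟩ := exists_flow_box hF hF₀ hW
  have hbox : ∀ y ∈ U, ∀ t ∈ Ioo (-ε) ε, Ψ (t, y) ∈ ψ.target ∧ ContDiffAt ℝ 1 F (Ψ (t, y)) ∧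
      ψ.symm (Ψ (t, y)) ∈ O := fun y hy t ht ↦
    hΨW (Ψ.map_source (by rw [hsrc]; exact ⟨ht, hy⟩))
  refine ⟨ψ.trans Ψ.symm, ε, U, ?_, hε, ?_, fun y hy t ht ↦ ?_⟩
  · rw [OpenPartialHomeomorph.trans_source]
    exact ⟨hx₀, hΨ₀⟩
  · rw [OpenPartialHomeomorph.trans_target, ← hsrc]
    refine inter_eq_left.2 fun q hq ↦ ?_
    exact (hΨW (Ψ.map_source hq)).1
  · change ψ.symm (Ψ (t, y)) ∈ O ∧
      ContMDiffAt 𝓘(ℝ, ℝ) (𝓡 n) 1 (fun t ↦ ψ.symm (Ψ (t, y))) t ∧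
      velocity (d := n) (fun t ↦ ψ.symm (Ψ (t, y))) t = v (ψ.symm (Ψ (t, y)))
    obtain ⟨h1, h2, h3⟩ := hbox y hy t ht
    have hnhds : Ioo (-ε) ε ∈ 𝓝 t := isOpen_Ioo.mem_nhds ht
    -- Bootstrap: the flow line is differentiable, hence continuous, so its derivative F ∘ Ψ is
    -- continuous and the flow line is C¹.
    have hcont : ContDiffAt ℝ 0 (fun s ↦ Ψ (s, y)) t := contDiffAt_zero.2 ⟨_, hnhds,
      fun s hs ↦ (hΨ y hy s hs).continuousAt.continuousWithinAt⟩
    have hΨ1 : ContDiffAt ℝ 1 (fun s ↦ Ψ (s, y)) t := by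
      have h4 : ContDiffAt ℝ ((0 : ℕ) : WithTop ℕ∞) (fun s ↦ F (Ψ (s, y))) t := by
        rw [Nat.cast_zero]
        exact ContDiffAt.comp (g := F) t (h2.of_le zero_le_one) hcont
      have h5 := contDiffAt_succ_of_hasDerivAt
        (Filter.mem_of_superset hnhds fun s hs ↦ hΨ y hy s hs) h4
      simpa using h5
    have hc : ContMDiffAt 𝓘(ℝ, ℝ) (𝓡 n) 1 (fun t ↦ ψ.symm (Ψ (t, y))) t :=
      ContMDiffAt.comp t (hsymm _ h1) hΨ1.contMDiffAt
    refine ⟨h3, hc, ?_⟩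
    have hs : ψ.symm (Ψ (t, y)) ∈ ψ.source := ψ.map_target h1
    have h6 := hasDerivAt_extChartAt_comp (hc.mdifferentiableAt one_ne_zero) hs
    have h7 : HasDerivAt (fun s ↦ extChartAt (𝓡 n) x₀ (ψ.symm (Ψ (s, y)))) (F (Ψ (t, y))) t := by
      refine (hΨ y hy t ht).congr_of_eventuallyEq ?_
      filter_upwards [hnhds] with s hs'
      exact ψ.right_inv (hbox y hy s hs').1
    -- Both compute the derivative of the curve in the chart at x₀: one gives the coordinates of its
    -- velocity, the other those of v.
    have h8 := h6.unique h7
    have hb : ψ.symm (Ψ (t, y)) ∈ (trivializationAt (EuclideanSpace ℝ (Fin n))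
      (fun p : P ↦ TangentSpace (𝓡 n) p) x₀).baseSet := by simpa using hs
    rw [fieldCoord_eq (f := fun t ↦ ψ.symm (Ψ (t, y))) _ hb] at h8
    exact ContinuousLinearEquiv.injective _ (h8.trans (sectionCoord_eq v hb))

end FlowBoxManifold

/-! ### The foliation by ruling curves. -/

section Foliation

variable {n : ℕ} {M : Type*} [TopologicalSpace M]
  [ChartedSpace (EuclideanSpace ℝ (Fin (n + 1))) M] [IsManifold (𝓡 (n + 1)) ∞ M]
  {S : SubRiemannianStructure (n + 1) M} {V : VerticallyRigidStructure S}
  {P : Type*} [TopologicalSpace P]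
  [ChartedSpace (EuclideanSpace ℝ (Fin n)) P] [IsManifold (𝓡 n) 2 P]
  {ι : P → M} {ν : (x : P) → TangentSpace (𝓡 (n + 1)) (ι x)}

theorem exists_ruling_chart (hrank : S.rank = 2)
    (hp : IsNoncharacteristicPatch (n := n) V ι ν) (x₀ : P) :
    ∃ (φ : OpenPartialHomeomorph P (ℝ × EuclideanSpace ℝ (Fin (n - 1))))
      (ε : ℝ) (U : Set (EuclideanSpace ℝ (Fin (n - 1)))),
      x₀ ∈ φ.source ∧ 0 < ε ∧ φ.target = Ioo (-ε) ε ×ˢ U ∧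
      ∀ y ∈ U, IsLawfulCurve (IsRulingAt V ι ν) (fun t ↦ φ.symm (t, y)) (Ioo (-ε) ε) := by
  obtain ⟨v, O, hO, hxO, hv⟩ := exists_local_ruling_field hrank hp x₀
  have hvr : ∀ x ∈ O, IsRulingVector V ι ν x (v x) := fun x hx ↦
    ⟨(hv x hx).2.2.1, (hv x hx).2.2.2.1, (hv x hx).2.2.2.2⟩
  obtain ⟨φ, ε, U, hx, hε, htar, hφ⟩ := exists_flow_box_manifold (hv x₀ hxO).1
    (hvr x₀ hxO).ne_zero (hO.mem_nhds hxO)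
  refine ⟨φ, ε, U, hx, hε, htar, fun y hy ↦ ⟨isOpen_Ioo, ordConnected_Ioo,
    nonempty_Ioo.2 (by linarith), fun t ht ↦ ?_⟩⟩
  obtain ⟨h1, h2, h3⟩ := hφ y hy t ht
  exact ⟨h2, h3 ▸ hvr _ h1⟩

theorem exists_isFoliationByCurves_isRulingCurve [T2Space P] (hrank : S.rank = 2)
    (hp : IsNoncharacteristicPatch (n := n) V ι ν) :
    ∃ L : Set (Set P), IsFoliationByCurves n (IsRulingCurve (n := n) V ι ν) L := by
  have h : IsRulingCurve (n := n) V ι ν = IsLawfulCurve (IsRulingAt V ι ν) := by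
    funext c J
    exact propext (isRulingCurve_iff hp)
  rw [h]
  exact exists_isFoliationByCurves n (isCurveLaw_isRulingAt hrank hp) (exists_ruling_chart hrank hp)

end Foliation

end SubRiemannianGeometry

theorem mainTheorem5 {n : ℕ}
    {M : Type*} [TopologicalSpace M] [T2Space M] [SecondCountableTopology M]
    [ChartedSpace (EuclideanSpace ℝ (Fin (n + 1))) M] [IsManifold (𝓡 (n + 1)) ∞ M]
    (S : SubRiemannianGeometry.SubRiemannianStructure (n + 1) M) (hrank : S.rank = 2)
    (V : SubRiemannianGeometry.VerticallyRigidStructure S)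
    (cov : SubRiemannianGeometry.TangentConnection (n + 1) M)
    (hcov : SubRiemannianGeometry.IsAdapted V cov)
    {P : Type*} [TopologicalSpace P] [T2Space P]
    [ChartedSpace (EuclideanSpace ℝ (Fin n)) P] [IsManifold (𝓡 n) 2 P]
    (ι : P → M) (ν : (x : P) → TangentSpace (𝓡 (n + 1)) (ι x))
    (hpatch : SubRiemannianGeometry.IsNoncharacteristicPatch (n := n) V ι ν)
    (hmin : SubRiemannianGeometry.IsMinimal (n := n) V cov ι ν) :
    (∀ (c : ℝ → P) (J : Set ℝ), SubRiemannianGeometry.IsRulingCurve (n := n) V ι ν c J →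
      SubRiemannianGeometry.IsGeodesicOn cov (fun t ↦ ι (c t)) J) ∧
    ∃ L : Set (Set P), SubRiemannianGeometry.IsFoliationByCurves n
      (SubRiemannianGeometry.IsRulingCurve (n := n) V ι ν) L :=
  ⟨fun _ _ h ↦ h.isGeodesicOn hrank hcov hpatch hmin,
    SubRiemannianGeometry.exists_isFoliationByCurves_isRulingCurve hrank hpatch⟩
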